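/- **Definitions.** All graphs are finite and simple, and $\mathrm{pm}(G)$ denotes the number of perfect matchings of $G$ (so $\mathrm{pm}(\emptyset)=1$). For a graph $G$, let $D(G)$ be the set of vertices left unmatched by at least one maximum matching of $G$, $A(G)$ the set of vertices outside $D(G)$ with a neighbour in $D(G)$, and $C(G)=V(G)\setminus(D(G)\cup A(G))$. A real number $a$ estimates $z\ge 0$ to within accuracy $\varepsilon$ if $(1-\varepsilon)z\le a\le(1+\varepsilon)z$. The permanent of a bipartite graph on $(X,Y)$ with edge weights $w\ge 0$ (weight $0$ for non-edges) is $\operatorname{per}(w)=\sum_{\sigma}\prod_{x\in X}w(x,\sigma(x))$, the sum being over all bijections $\sigma:X\to Y$ (so it is $0$ if $|X|\ne|Y|$). For a vertex $u$ of $G$, let $X=A(G-u)\cup\{u\}$, let $Y$ be the set of connected components of the subgraph of $G-u$ induced on $D(G-u)$, and for $v\in D(G-u)$ let $H_v\in Y$ be the component containing $v$. For numbers $m_v$ $(v\in D(G-u))$, put $w_m(x,H)=\sum_{v\in N_G(x)\cap H}m_v$ for $x\in X$, $H\in Y$. Let $\textsc{Permanent}$ be a (possibly randomized) subroutine which, for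 every finite bipartite graph with nonnegative edge weights and every $0<\delta\le 1$, returns a value, every value it may return being an estimate of the permanent to within accuracy $\delta$. The procedure $\textsc{Recursive-Count}(G,\varepsilon)$ is as follows. If $V(G)=\emptyset$, return $1$. Otherwise choose any $u\in V(G)$; let $n=|V(G)|$; for every $v\in D(G-u)$ let $m_v$ be the result of $\textsc{Recursive-Count}(H_v-v,\varepsilon/(2n))$; let $m_C$ be the result of $\textsc{Recursive-Count}$ on the subgraph induced on $C(G-u)$ with accuracy $\varepsilon/3$; return $m_C\cdot\textsc{Permanent}(w_m,\varepsilon/3)$. **Theorem.** Let $G$ be a finite graph. 1. For every vertex $u$ of $G$, with the exact counts $m_v=\mathrm{pm}(H_v-v)$, $$\mathrm{pm}\big(G[C(G-u)]\big)\cdot\operatorname{per}(w_m)=\mathrm{pm}(G).$$ 2. For every such subroutine, every rule for choosing the vertices $u$, and every $0<\varepsilon\le 1$, $\textsc{Recursive-Count}(G,\varepsilon)$ returns a value, and every value it may return estimates $\mathrm{pm}(G)$ to within accuracy $\varepsilon$. -/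

import Mathlib

universe u

namespace RecCount

/-- The number of perfect matchings of `G`. -/
noncomputable def numPM {V : Type u} (G : SimpleGraph V) : ℕ :=
  Nat.card {M : G.Subgraph // M.IsPerfectMatching}

/-- A matching with the largest number of edges. -/
def IsMaximumMatching {V : Type u} {G : SimpleGraph V} (M : G.Subgraph) : Prop :=
  M.IsMatching ∧ ∀ M' : G.Subgraph, M'.IsMatching → M'.edgeSet.ncard ≤ M.edgeSet.ncard

/-- `D(G)`: the vertices left unmatched by at least one maximum matching. -/
def geD {V : Type u} (G : SimpleGraph V) : Set V :=
  {v | ∃ M : G.Subgraph, IsMaximumMatching M ∧ v ∉ M.verts}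

/-- `A(G)`: the vertices outside `D(G)` with a neighbour in `D(G)`. -/
def geA {V : Type u} (G : SimpleGraph V) : Set V :=
  {v | v ∉ geD G ∧ ∃ w ∈ geD G, G.Adj v w}

/-- `C(G)`: the remaining vertices. -/
def geC {V : Type u} (G : SimpleGraph V) : Set V :=
  {v | v ∉ geD G ∧ v ∉ geA G}

/-- `G - u`. -/
abbrev del {V : Type u} (G : SimpleGraph V) (u : V) : SimpleGraph ({u}ᶜ : Set V) :=
  G.induce {u}ᶜ

/-- The subgraph of `G - u` induced on `D(G - u)`. -/
abbrev dGraph {V : Type u} (G : SimpleGraph V) (u : V) : SimpleGraph (geD (del G u)) :=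
  (del G u).induce (geD (del G u))

/-- The subgraph of `G - u` induced on `C(G - u)`. -/
abbrev cGraph {V : Type u} (G : SimpleGraph V) (u : V) : SimpleGraph (geC (del G u)) :=
  (del G u).induce (geC (del G u))

/-- `H_v - v`, where `H_v` is the connected component of `D(G - u)` containing `v`. -/
abbrev hGraph {V : Type u} (G : SimpleGraph V) (u : V) (v : geD (del G u)) :
    SimpleGraph (((dGraph G u).connectedComponentMk v).supp \ {v} : Set (geD (del G u))) :=
  (dGraph G u).induce (((dGraph G u).connectedComponentMk v).supp \ {v})

/-- `X = A(G - u) ∪ {u}`, as a set of vertices of `G`. -/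
abbrev leftSide {V : Type u} (G : SimpleGraph V) (u : V) : Set V :=
  insert u (Subtype.val '' geA (del G u))

/-- `Y`: the connected components of `D(G - u)`. -/
abbrev rightSide {V : Type u} (G : SimpleGraph V) (u : V) : Type u :=
  (dGraph G u).ConnectedComponent

/-- The edge weights `w(x, H) = ∑_{v ∈ N(x) ∩ H} m_v` of the bipartite graph on `(X, Y)`;
the weight is `0` where there is no edge. -/
noncomputable def weight {V : Type u} (G : SimpleGraph V) (u : V) (m : geD (del G u) → ℝ)
    (x : leftSide G u) (H : rightSide G u) : ℝ :=
  ∑ᶠ (v : geD (del G u))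
    (_ : (dGraph G u).connectedComponentMk v = H ∧ G.Adj (x : V) ((v : ({u}ᶜ : Set V)) : V)), m v

/-- The permanent of a weighted bipartite graph on `(X, Y)`: the total weight of its perfect
matchings, which is `0` if the two sides have different sizes. -/
noncomputable def permanent {X Y : Type u} (w : X → Y → ℝ) : ℝ :=
  ∑ᶠ σ : X ≃ Y, ∏ᶠ x, w x (σ x)

/-- `a` estimates `z` to within (relative) accuracy `ε`: `(1 - ε) z ≤ a ≤ (1 + ε) z`. -/
def Within (ε a z : ℝ) : Prop :=
  (1 - ε) * z ≤ a ∧ a ≤ (1 + ε) * z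

/-- A subroutine that is called with a weighted bipartite graph and an accuracy; its value is the
set of possible return values (several, if it is randomized). -/
abbrev Subroutine : Type (u + 1) :=
  ∀ X Y : Type u, (X → Y → ℝ) → ℝ → Set ℝ

/-- The subroutine computes permanents of nonnegatively weighted finite bipartite graphs: it
returns a value, and every value it may return is within the requested accuracy. -/
def Subroutine.ComputesPermanent (P : Subroutine.{u}) : Prop :=
  ∀ (X Y : Type u) [Finite X] [Finite Y] (w : X → Y → ℝ) (ε : ℝ),
    (∀ x y, 0 ≤ w x y) → 0 < ε → ε ≤ 1 →
      (P X Y w ε).Nonempty ∧ ∀ p ∈ P X Y w ε, Within ε p (permanent w)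

/-- A rule for the choice of `u`: the set of vertices that may be chosen in the call with
a given graph and accuracy. -/
abbrev ChoiceRule : Type (u + 1) :=
  ∀ V : Type u, SimpleGraph V → ℝ → Set V

/-- The rule offers a vertex in every nonempty finite graph. -/
def ChoiceRule.Total (U : ChoiceRule.{u}) : Prop :=
  ∀ (V : Type u) [Finite V] [Nonempty V] (G : SimpleGraph V) (ε : ℝ), (U V G ε).Nonempty

/-- `Returns P U G ε r`: the recursive algorithm, called with `(G, ε)`, may return `r`, when it
uses the subroutine `P` for permanents and the rule `U` for choosing the vertex `u`. -/
inductive Returns (P : Subroutine.{u}) (U : ChoiceRule.{u}) :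
    ∀ {V : Type u}, SimpleGraph V → ℝ → ℝ → Prop
  | empty {V : Type u} [IsEmpty V] (G : SimpleGraph V) (ε : ℝ) : Returns P U G ε 1
  | step {V : Type u} (G : SimpleGraph V) (ε : ℝ) (u : V) (hu : u ∈ U V G ε)
      (m : geD (del G u) → ℝ)
      (hm : ∀ v, Returns P U (hGraph G u v) (ε / (2 * (Nat.card V : ℝ))) (m v))
      (mC : ℝ) (hC : Returns P U (cGraph G u) (ε / 3) mC)
      (p : ℝ) (hp : p ∈ P (leftSide G u) (rightSide G u) (weight G u m) (ε / 3)) :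
      Returns P U G ε (mC * p)

end RecCount

/-! The identity comes from the Gallai–Edmonds structure of `G - u`. If `F` is a perfect matching of
`G`, its restriction to `G - u` misses only the partner of `u`; by parity every matching of `G - u`
misses a vertex, so this restriction is maximum. Hence it matches `A(G - u)` into `D(G - u)`, and
each component of `D(G - u)` has exactly one vertex that is missed or matched to `A(G - u)`. In `G`
this says that `F` joins `X = A(G - u) ∪ {u}` bijectively to the components, by edges `x τ(x)`. What
remains is `C(G - u)` and the sets `H - τ(x)`, with no edges between different pieces, so `F` is a
choice of `τ` together with independent perfect matchings of the pieces. Conversely any such data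
glue to a perfect matching. Expanding the permanent of the weights gives the same sum over `τ`.

The structure theorem is proved with matchings as involutions, unmatched vertices being fixed
points. Orbits of two involutions are alternating paths, and exchanging matchings on an orbit gives
Gallai's lemma and the stability lemma. Isolating all of `A` then reduces the claim on components to
Gallai's lemma and parity.

For the accuracy, a one-vertex component has `H_v - v` empty and causes no error. Every other
component used by `τ` accounts for three vertices of its own, so at most `n/3` factors are inexact.
The upper bound is carried through the induction as `exp (2ε/3)`, which reproduces itself and is at
most `1 + ε`. -/

namespace RecCount

open Function Set

variable {V : Type u} {G : SimpleGraph V}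

/-! ### Involutions and alternating paths -/

/-- A matching, encoded as the involution that exchanges the ends of its edges and fixes the
unmatched vertices. -/
def IsInvMatching (G : SimpleGraph V) (f : V → V) : Prop :=
  Involutive f ∧ ∀ v, f v = v ∨ G.Adj v (f v)

/-- A maximum matching, encoded as an involution. -/
def IsMaxInv (G : SimpleGraph V) (f : V → V) : Prop :=
  IsInvMatching G f ∧
    ∀ g, IsInvMatching G g → (fixedPoints f).ncard ≤ (fixedPoints g).ncard

/-- The orbit of a point `v` fixed by an involution `f` under `f` and a second involution `g` is
an alternating path: besides `v` it has exactly one end, which is fixed by `f` or by `g`. -/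
lemma exists_alternating_orbit [Finite V] {f g : V → V} (hf : Involutive f) (hg : Involutive g)
    {v : V} (hv : f v = v) :
    ∃ S : Set V, v ∈ S ∧ (∀ x ∈ S, f x ∈ S) ∧ (∀ x ∈ S, g x ∈ S) ∧ ∃ w,
      ((fixedPoints f ∩ S = {v} ∧ fixedPoints g ∩ S = {w}) ∨
        (w ≠ v ∧ fixedPoints f ∩ S = {v, w} ∧ fixedPoints g ∩ S = ∅)) := by
  let F : Equiv.Perm V := hf.toPerm f
  let K : Equiv.Perm V := hg.toPerm g
  let π : Equiv.Perm V := K * F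
  have hFF : F⁻¹ = F := rfl
  have hKK : K⁻¹ = K := rfl
  have hfa (x) : F x = f x := rfl
  have hga (x) : K x = g x := rfl
  have hconj : F * π * F⁻¹ = π⁻¹ := by
    simp only [π, mul_inv_rev, hFF, hKK]
    ext x; simp [hfa, hga, hf _]
  -- Index the orbit of `v` under `π = g ∘ f` by integers: `f` acts as the reflection `n ↦ -n` and
  -- `g` as `n ↦ 1 - n`. Fixed points thus become the congruences `2n ≡ 0` and `2n ≡ 1` modulo the
  -- period `L`.
  have hfn (n : ℤ) : f ((π ^ n) v) = (π ^ (-n)) v := by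
    have h1 : F * π ^ n * F⁻¹ = π ^ (-n) := by rw [← conj_zpow, hconj, inv_zpow, zpow_neg]
    rw [← h1, hFF]; simp [hfa, hv]
  have hgn (n : ℤ) : g ((π ^ n) v) = (π ^ (1 - n)) v := by
    have h1 : g ((π ^ n) v) = π (f ((π ^ n) v)) := by
      simp [π, hfa, hga, hf _]
    rw [h1, hfn, ← Equiv.Perm.mul_apply, ← zpow_one_add, sub_eq_add_neg]
  let L := minimalPeriod π v
  have hL : 0 < L := minimalPeriod_pos_of_mem_periodicPts
    (π.injective.mem_periodicPts v)
  have hLn (n : ℕ) : (π ^ (n : ℤ)) v = v ↔ L ∣ n := by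
    rw [zpow_natCast, ← isPeriodicPt_iff_minimalPeriod_dvd, IsPeriodicPt, IsFixedPt,
      Equiv.Perm.iterate_eq_pow]
  have hLz (n : ℤ) : (π ^ n) v = v ↔ (L : ℤ) ∣ n := by
    obtain ⟨k, rfl | rfl⟩ := n.eq_nat_or_neg
    · rw [hLn, Int.natCast_dvd_natCast]
    · rw [zpow_neg, Equiv.Perm.inv_eq_iff_eq, eq_comm, hLn, dvd_neg, Int.natCast_dvd_natCast]
  have heq (m n : ℤ) : (π ^ m) v = (π ^ n) v ↔ (L : ℤ) ∣ m - n := by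
    rw [← hLz, sub_eq_neg_add, zpow_add, Equiv.Perm.mul_apply, zpow_neg,
      Equiv.Perm.inv_eq_iff_eq]
  refine ⟨range fun n : ℤ => (π ^ n) v, ⟨0, by simp⟩, ?_, ?_, ?_⟩
  · rintro _ ⟨n, rfl⟩; exact ⟨-n, (hfn n).symm⟩
  · rintro _ ⟨n, rfl⟩; exact ⟨1 - n, (hgn n).symm⟩
  have hffix (n : ℤ) : f ((π ^ n) v) = (π ^ n) v ↔ (L : ℤ) ∣ 2 * n := by
    rw [hfn, heq, ← dvd_neg]; ring_nf
  have hgfix (n : ℤ) : g ((π ^ n) v) = (π ^ n) v ↔ (L : ℤ) ∣ 2 * n - 1 := by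
    rw [hgn, heq, ← dvd_neg]; ring_nf
  have hv0 : v = (π ^ (0 : ℤ)) v := by simp
  -- For `L = 2k` the first congruence has the solutions `0` and `k` and the second none. For `L =
  -- 2k + 1` each has one solution, `0` and `k + 1`, since `2` is invertible modulo `L`.
  rcases Nat.even_or_odd' L with ⟨k, hk | hk⟩
  · refine ⟨(π ^ (k : ℤ)) v, Or.inr ⟨?_, ?_, ?_⟩⟩
    · intro h
      rw [hLz, Int.natCast_dvd_natCast] at h
      have := Nat.le_of_dvd (by omega) h
      omega
    · ext x
      simp only [mem_inter_iff, mem_fixedPoints, IsFixedPt, mem_range, mem_insert_iff,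
        mem_singleton_iff]
      constructor
      · rintro ⟨h, n, rfl⟩
        rw [hffix] at h
        obtain ⟨c, hc⟩ := h
        rw [hLz, heq]
        have hn : n = k * c := by
          have : (L : ℤ) = 2 * k := by exact_mod_cast hk
          rw [this] at hc; linarith
        rcases Int.even_or_odd' c with ⟨d, rfl | rfl⟩
        · left; exact ⟨d, by rw [hn, hk]; push_cast; ring⟩
        · right; exact ⟨d, by rw [hn, hk]; push_cast; ring⟩
      · rintro (rfl | rfl)
        · exact ⟨hv, 0, by simp⟩
        · exact ⟨(hffix _).2 ⟨1, by rw [hk]; push_cast; ring⟩, k, rfl⟩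
    · ext x
      simp only [mem_inter_iff, mem_fixedPoints, IsFixedPt, mem_range, mem_empty_iff_false,
        iff_false]
      rintro ⟨h, n, rfl⟩
      rw [hgfix] at h
      obtain ⟨c, hc⟩ := h
      have : (L : ℤ) = 2 * k := by exact_mod_cast hk
      rw [this, mul_assoc] at hc
      omega
  · have hLk : (L : ℤ) = 2 * k + 1 := by exact_mod_cast hk
    refine ⟨(π ^ ((k : ℤ) + 1)) v, Or.inl ⟨?_, ?_⟩⟩
    · ext x
      simp only [mem_inter_iff, mem_fixedPoints, IsFixedPt, mem_range, mem_singleton_iff]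
      constructor
      · rintro ⟨h, n, rfl⟩
        rw [hffix] at h
        rw [hLz]
        exact (IsCoprime.dvd_of_dvd_mul_left ⟨1, -k, by rw [hLk]; ring⟩ h)
      · rintro rfl
        exact ⟨hv, 0, by simp⟩
    · ext x
      simp only [mem_inter_iff, mem_fixedPoints, IsFixedPt, mem_range, mem_singleton_iff]
      constructor
      · rintro ⟨h, n, rfl⟩
        rw [hgfix] at h
        rw [heq]
        have h2 : (L : ℤ) ∣ 2 * (n - (k + 1)) := by
          have := dvd_sub h (dvd_refl (L : ℤ))
          have e : 2 * n - 1 - (L : ℤ) = 2 * (n - (k + 1)) := by rw [hLk]; ring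
          rwa [e] at this
        exact (IsCoprime.dvd_of_dvd_mul_left ⟨1, -k, by rw [hLk]; ring⟩ h2)
      · rintro rfl
        exact ⟨(hgfix _).2 ⟨1, by rw [hLk]; ring⟩, _, rfl⟩

/-! ### Exchanging matchings on a set and adding an edge -/

section Surgery

variable {f g : V → V}

open Classical in
lemma IsInvMatching.piecewise (hf : IsInvMatching G f) (hg : IsInvMatching G g) {S : Set V}
    (hfS : ∀ x ∈ S, f x ∈ S) (hgS : ∀ x ∈ S, g x ∈ S) :
    IsInvMatching G (S.piecewise f g) := by
  have hgS' (x) (hx : x ∉ S) : g x ∉ S := fun h => hx (hg.1 x ▸ hgS _ h)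
  refine ⟨fun x => ?_, fun x => ?_⟩ <;> by_cases hx : x ∈ S
  · simp [hx, hfS x hx, hf.1 x]
  · simp [hx, hgS' x hx, hg.1 x]
  · simpa [hx] using hf.2 x
  · simpa [hx] using hg.2 x

-- Off `S` the two matchings agree, so only the fixed points in `S` are traded. The additive form
-- avoids subtraction in `ℕ`.
open Classical in
lemma ncard_fixedPoints_piecewise [Finite V] (f g : V → V) (S : Set V) :
    (fixedPoints (S.piecewise f g)).ncard + (fixedPoints g ∩ S).ncard =
      (fixedPoints f ∩ S).ncard + (fixedPoints g).ncard := by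
  have h1 : fixedPoints (S.piecewise f g) = (fixedPoints f ∩ S) ∪ (fixedPoints g \ S) := by
    ext x
    by_cases hx : x ∈ S <;> simp [IsFixedPt, hx]
  rw [h1, ncard_union_eq (disjoint_sdiff_right.mono_left inter_subset_right), add_assoc,
    add_comm (ncard _) (ncard (_ ∩ S)), ncard_inter_add_ncard_sdiff_eq_ncard]

open Classical in
lemma IsInvMatching.exists_add_edge [Finite V] (hf : IsInvMatching G f) {x y : V}
    (hxy : G.Adj x y) (hx : f x = x) (hy : f y = y) :
    ∃ f', IsInvMatching G f' ∧ (fixedPoints f').ncard + 2 = (fixedPoints f).ncard ∧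
      ∀ v, v ≠ x → v ≠ y → f' v = f v := by
  have hne := hxy.ne
  have hinj := hf.1.injective
  have hfx (v) : f v = x ↔ v = x := by rw [← hinj.eq_iff (a := v), hx]
  have hfy (v) : f v = y ↔ v = y := by rw [← hinj.eq_iff (a := v), hy]
  refine ⟨fun v => if v = x then y else if v = y then x else f v, ⟨fun v => ?_, fun v => ?_⟩,
    ?_, fun v h1 h2 => by simp [h1, h2]⟩
  · by_cases h1 : v = x
    · simp [h1, hne.symm]
    · by_cases h2 : v = y
      · simp [h2, hne.symm]
      · simp [h1, h2, hfx, hfy, hf.1 v]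
  · by_cases h1 : v = x
    · simp [h1, hxy]
    · by_cases h2 : v = y
      · simp [h2, hne.symm, hxy.symm]
      · simpa [h1, h2] using hf.2 v
  · have : fixedPoints (fun v => if v = x then y else if v = y then x else f v) =
        fixedPoints f \ {x, y} := by
      ext v
      by_cases h1 : v = x
      · simp [IsFixedPt, h1, hne.symm]
      · by_cases h2 : v = y
        · simp [IsFixedPt, h2, hne.symm, hne]
        · simp [IsFixedPt, h1, h2]
    rw [this, ← ncard_pair hne, ncard_sdiff_add_ncard_of_subset]
    rintro v (rfl | rfl) <;> assumption

end Surgery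

lemma IsMaxInv.of_ncard_eq {f g : V → V} (hf : IsMaxInv G f) (hg : IsInvMatching G g)
    (h : (fixedPoints g).ncard = (fixedPoints f).ncard) : IsMaxInv G g :=
  ⟨hg, fun k hk => h ▸ hf.2 k hk⟩

lemma IsMaxInv.ncard_eq {f g : V → V} (hf : IsMaxInv G f) (hg : IsMaxInv G g) :
    (fixedPoints g).ncard = (fixedPoints f).ncard :=
  le_antisymm (hg.2 f hf.1) (hf.2 g hg.1)

/-- The vertices missed by some maximum matching. -/
def invD (G : SimpleGraph V) : Set V := {v | ∃ f, IsMaxInv G f ∧ f v = v}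

/-! ### Gallai's lemma -/

section Gallai

variable [Finite V]

lemma IsMaxInv.not_adj {f : V → V} (hf : IsMaxInv G f) {x y : V} (hx : f x = x) (hy : f y = y) :
    ¬ G.Adj x y := by
  intro h
  obtain ⟨f', hf', hc, -⟩ := hf.1.exists_add_edge h hx hy
  have := hf.2 f' hf'
  omega

/-- If one maximum matching misses two vertices `x ≠ y` and another one misses `z`, then some
maximum matching misses `z` together with `x` or `y`. -/
lemma IsMaxInv.exists_exchange {f g : V → V} (hf : IsMaxInv G f) (hg : IsMaxInv G g) {x y z : V}
    (hxy : x ≠ y) (hx : g x = x) (hy : g y = y) (hz : f z = z) :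
    ∃ h, IsMaxInv G h ∧ h z = z ∧ (h x = x ∨ h y = y) := by
  classical
  obtain ⟨S, hzS, hfS, hgS, w, ⟨h1, h2⟩ | ⟨hwz, h1, h2⟩⟩ := exists_alternating_orbit hf.1.1 hg.1.1 hz
  -- The path has one end missed by each matching, so using `f` on it keeps `g` maximum. Only one
  -- vertex missed by `g` lies on it, so `x` or `y` lies outside and stays missed.
  · have hcard := ncard_fixedPoints_piecewise f g S
    rw [h1, h2, ncard_singleton, ncard_singleton] at hcard
    refine ⟨S.piecewise f g, hg.of_ncard_eq (hf.1.piecewise hg.1 hfS hgS) (by omega),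
      by simp [hzS, hz], ?_⟩
    by_cases hxS : x ∈ S
    · have hxw : x = w := by
        have : x ∈ fixedPoints g ∩ S := ⟨hx, hxS⟩
        rwa [h2] at this
      have hyS : y ∉ S := fun hyS => by
        have : y ∈ fixedPoints g ∩ S := ⟨hy, hyS⟩
        rw [h2] at this
        exact hxy (hxw.trans (mem_singleton_iff.1 this).symm)
      right; simp [hyS, hy]
    · left; simp [hxS, hx]
  -- Both ends are missed by `f`: the path is augmenting, against the maximality of `f`.
  · have hcard := ncard_fixedPoints_piecewise g f S
    rw [h1, h2, ncard_pair hwz.symm, ncard_empty] at hcard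
    have := hf.2 _ (hg.1.piecewise hf.1 hgS hfS)
    omega

/-- **Gallai's lemma**: a maximum matching misses at most one vertex of each component of the
subgraph induced on `D(G)`. -/
lemma IsMaxInv.eq_of_reachable {f : V → V} (hf : IsMaxInv G f) {x y : invD G}
    (hxy : (G.induce (invD G)).Reachable x y) (hx : f x = x) (hy : f y = y) : x = y := by
  rw [SimpleGraph.reachable_iff_reflTransGen] at hxy
  -- The matching must vary: the exchange yields a new maximum matching that misses `z` and one of
  -- `x`, `y`. Missing `x` and `z` is excluded by induction, missing the adjacent `z` and `y` by
  -- maximality.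
  induction hxy generalizing f with
  | refl => rfl
  | @tail z y _ hzy ih =>
    by_contra hne
    have hzy' : G.Adj z y := hzy
    have hxz : x ≠ z := by
      rintro rfl
      exact hf.not_adj hx hy hzy'
    obtain ⟨g, hg, hgz⟩ := z.2
    obtain ⟨h, hh, hhz, h1 | h1⟩ := hg.exists_exchange hf (Subtype.coe_ne_coe.2 hne) hx hy hgz
    · exact hxz (ih hh h1 hhz)
    · exact hh.not_adj hhz h1 hzy'

end Gallai

/-! ### Isolating vertices, and parity -/

/-- The graph `G` with all edges at vertices of `B` removed. -/
def isolate (G : SimpleGraph V) (B : Set V) : SimpleGraph V where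
  Adj x y := G.Adj x y ∧ x ∉ B ∧ y ∉ B
  symm := ⟨fun _ _ h => ⟨h.1.symm, h.2.2, h.2.1⟩⟩
  loopless := ⟨fun x h => G.loopless.irrefl x h.1⟩

lemma isolate_adj {B : Set V} {x y : V} :
    (isolate G B).Adj x y ↔ G.Adj x y ∧ x ∉ B ∧ y ∉ B := Iff.rfl

lemma isolate_empty (G : SimpleGraph V) : isolate G ∅ = G := by
  ext x y; simp [isolate_adj]

lemma isolate_insert (G : SimpleGraph V) (a : V) (B : Set V) :
    isolate G (insert a B) = isolate (isolate G B) {a} := by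
  ext x y; simp only [isolate_adj, mem_insert_iff, mem_singleton_iff]; tauto

open Classical in
/-- The matching `f` without its edges at vertices of `B`. -/
noncomputable def strip (f : V → V) (B : Set V) (v : V) : V := if v ∈ B ∨ f v ∈ B then v else f v

lemma strip_empty (f : V → V) : strip f ∅ = f := by
  ext v; simp [strip]

lemma strip_insert {f : V → V} (a : V) (B : Set V) :
    strip f (insert a B) = strip (strip f B) {a} := by
  ext v
  simp only [strip, mem_insert_iff, mem_singleton_iff]
  grind

lemma IsInvMatching.strip {f : V → V} (hf : IsInvMatching G f) (B : Set V) :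
    IsInvMatching (isolate G B) (strip f B) := by
  refine ⟨fun v => ?_, fun v => ?_⟩ <;> simp only [RecCount.strip]
  · have := hf.1 v
    grind
  · by_cases h : v ∈ B ∨ f v ∈ B
    · simp [h]
    · rw [if_neg h]
      push Not at h
      exact (hf.2 v).imp_right fun h' => ⟨h', h⟩

lemma strip_eq_self_iff {f : V → V} {B : Set V} {v : V} :
    strip f B v = v ↔ f v = v ∨ v ∈ B ∨ f v ∈ B := by
  simp only [strip]; grind

lemma IsInvMatching.of_isolate {f : V → V} {B : Set V} (hf : IsInvMatching (isolate G B) f) :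
    IsInvMatching G f :=
  ⟨hf.1, fun v => (hf.2 v).imp_right And.left⟩

lemma IsInvMatching.apply_of_mem_isolate {f : V → V} {B : Set V}
    (hf : IsInvMatching (isolate G B) f) {v : V} (hv : v ∈ B) : f v = v :=
  (hf.2 v).resolve_right fun h => h.2.1 hv

lemma even_ncard_add_ncard_fixedPoints [Finite V] {f : V → V} (hf : Involutive f) {S : Set V}
    (hS : ∀ x ∈ S, f x ∈ S) : Even (S.ncard + (fixedPoints f ∩ S).ncard) := by
  classical
  have := Fintype.ofFinite V
  let g : S → S := fun x => ⟨f x, hS x x.2⟩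
  have hg : Involutive g := fun x => Subtype.ext (hf x)
  have hfix : (fixedPoints f ∩ S).ncard = Fintype.card (fixedPoints g) := by
    rw [← Nat.card_eq_fintype_card, Nat.card_coe_set_eq,
      ← ncard_image_of_injective _ Subtype.val_injective]
    congr 1
    ext x
    simp [g, IsFixedPt, Subtype.ext_iff]
  have h := Equiv.Perm.card_fixedPoints_modEq (f := g) (p := 2) (n := 1) (by
    exact (pow_two (M := Function.End S) g).trans (funext hg))
  rw [hfix, ← Nat.card_coe_set_eq, Nat.card_eq_fintype_card, Nat.even_add]
  rw [Nat.even_iff, Nat.even_iff]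
  rw [Nat.ModEq] at h
  omega

lemma even_ncard_fixedPoints_add [Finite V] {f g : V → V} (hf : Involutive f) (hg : Involutive g) :
    Even ((fixedPoints f).ncard + (fixedPoints g).ncard) := by
  have h1 := even_ncard_add_ncard_fixedPoints hf (S := univ) (by simp)
  have h2 := even_ncard_add_ncard_fixedPoints hg (S := univ) (by simp)
  rw [inter_univ] at h1 h2
  rw [Nat.even_add] at *
  tauto

/-! ### The stability lemma and the Gallai–Edmonds structure -/

section Stability

variable [Finite V] {a : V}

/-- As a matching of `G`, `g` misses `a ∉ D(G)`, so it is not maximum; parity widens the gap from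
one to two. -/
lemma ncard_le_of_isolate {f g : V → V} (hf : IsMaxInv G f) (ha : a ∉ invD G)
    (hg : IsInvMatching (isolate G {a}) g) :
    (fixedPoints f).ncard + 2 ≤ (fixedPoints g).ncard := by
  have hga : g a = a := hg.apply_of_mem_isolate rfl
  have h1 := hf.2 g hg.of_isolate
  have h2 : (fixedPoints g).ncard ≠ (fixedPoints f).ncard := fun h =>
    ha ⟨g, hf.of_ncard_eq hg.of_isolate h, hga⟩
  have h3 := even_ncard_fixedPoints_add hf.1.1 hg.1
  rw [Nat.even_iff] at h3
  omega

lemma ncard_fixedPoints_strip {f : V → V} (hf : IsMaxInv G f) (ha : a ∉ invD G) :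
    (fixedPoints (strip f {a})).ncard = (fixedPoints f).ncard + 2 := by
  have hfa : f a ≠ a := fun h => ha ⟨f, hf, h⟩
  have h1 : fixedPoints (strip f {a}) = fixedPoints f ∪ {a, f a} := by
    ext v
    have := hf.1.1 v
    have := hf.1.1 a
    simp only [mem_fixedPoints, IsFixedPt, strip_eq_self_iff, mem_singleton_iff, mem_union,
      mem_insert_iff]
    grind
  rw [h1, ncard_union_eq, ncard_pair hfa.symm]
  rw [Set.disjoint_right]
  rintro v (rfl | rfl) h
  · exact hfa h
  · exact hfa (hf.1.1.injective h)

lemma IsMaxInv.strip_singleton {f : V → V} (hf : IsMaxInv G f) (ha : a ∉ invD G) :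
    IsMaxInv (isolate G {a}) (strip f {a}) :=
  ⟨hf.1.strip _, fun _ hg => ncard_fixedPoints_strip hf ha ▸ ncard_le_of_isolate hf ha hg⟩

/-- The **stability lemma**: removing the edges at a vertex of `A(G)` does not change the set of
missed vertices otherwise. -/
lemma invD_isolate_singleton (ha : a ∉ invD G) {d : V} (hd : d ∈ invD G) (had : G.Adj a d) :
    invD (isolate G {a}) = insert a (invD G) := by
  classical
  obtain ⟨g, hg, hgd⟩ := hd
  ext v
  constructor
  · rintro ⟨f, hf, hfv⟩
    by_contra hv
    rw [mem_insert_iff, not_or] at hv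
    have hcf : (fixedPoints f).ncard = (fixedPoints g).ncard + 2 := by
      rw [← ncard_fixedPoints_strip hg ha]
      exact (hg.strip_singleton ha).ncard_eq hf
    have hfa : f a = a := hf.1.apply_of_mem_isolate rfl
    have hfG := hf.1.of_isolate
    obtain ⟨S, hvS, hfS, hgS, w, ⟨h1, h2⟩ | ⟨hwv, h1, h2⟩⟩ :=
      exists_alternating_orbit hfG.1 hg.1.1 hfv
    · have hcard := ncard_fixedPoints_piecewise f g S
      rw [h1, h2, ncard_singleton, ncard_singleton] at hcard
      exact hv.2 ⟨S.piecewise f g, hg.of_ncard_eq (hfG.piecewise hg.1 hfS hgS) (by omega),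
        by simp [hvS, hfv]⟩
    -- Now both ends of the path are missed by `f`. If it contains `a`, taking `f` on it and `g`
    -- elsewhere misses two vertices more than `g`, among them `a` and `d`; adding the edge `ad`
    -- repairs this, and `v` is still missed.
    · by_cases haS : a ∈ S
      · have hdS : d ∉ S := fun hdS => by
          have : d ∈ fixedPoints g ∩ S := ⟨hgd, hdS⟩
          simp [h2] at this
        have hcard := ncard_fixedPoints_piecewise f g S
        rw [h1, h2, ncard_pair hwv.symm, ncard_empty] at hcard
        obtain ⟨h, hh, hch, hhv⟩ := (hfG.piecewise hg.1 hfS hgS).exists_add_edge had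
          (by simp [haS, hfa]) (by simp [hdS, hgd])
        refine hv.2 ⟨h, hg.of_ncard_eq hh (by omega), ?_⟩
        rw [hhv v hv.1 (by rintro rfl; exact hdS hvS)]
        simp [hvS, hfv]
      -- If the path avoids `a`, augmenting `f` along it gives a maximum matching of `G` that still
      -- misses `a`.
      · have hcard := ncard_fixedPoints_piecewise g f S
        rw [h1, h2, ncard_pair hwv.symm, ncard_empty] at hcard
        exact ha ⟨S.piecewise g f, hg.of_ncard_eq (hg.1.piecewise hfG hgS hfS) (by omega),
          by simp [haS, hfa]⟩
  · rintro (rfl | ⟨f, hf, hfv⟩)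
    · exact ⟨_, hg.strip_singleton ha, by simp [strip]⟩
    · exact ⟨_, hf.strip_singleton ha, by simp [strip, hfv]⟩

/-- `A(G)`, with respect to matchings encoded as involutions. -/
def invA (G : SimpleGraph V) : Set V := {v | v ∉ invD G ∧ ∃ w ∈ invD G, G.Adj v w}

/-- The stability lemma is applied to one vertex at a time. It remains applicable because `B` is
disjoint from `D(G)`: the next vertex keeps its neighbour in `D(G)` and stays outside the enlarged
set of missed vertices. -/
lemma isolate_of_subset_invA {B : Set V} (hB : B ⊆ invA G) :
    invD (isolate G B) = invD G ∪ B ∧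
      ∀ f, IsMaxInv G f → IsMaxInv (isolate G B) (strip f B) := by
  induction B, B.toFinite using Set.Finite.induction_on with
  | empty => simp [isolate_empty, strip_empty]
  | @insert a B haB _ ih =>
    obtain ⟨ih1, ih2⟩ := ih ((subset_insert _ _).trans hB)
    obtain ⟨haD, d, hd, had⟩ := hB (mem_insert a B)
    have haD' : a ∉ invD (isolate G B) := by
      rw [ih1]; simp [haD, haB]
    have hdB : d ∉ B := fun h => (hB (mem_insert_of_mem _ h)).1 hd
    refine ⟨?_, fun f hf => ?_⟩
    · rw [isolate_insert, invD_isolate_singleton haD' (d := d) (by rw [ih1]; exact Or.inl hd)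
        ⟨had, haB, hdB⟩, ih1, union_insert]
    · rw [isolate_insert, strip_insert]
      exact (ih2 f hf).strip_singleton haD'

/-- A maximum matching matches `A(G)` into `D(G)`. -/
lemma IsMaxInv.apply_mem_invD {f : V → V} (hf : IsMaxInv G f) (ha : a ∈ invA G) :
    f a ∈ invD G := by
  have h1 : f a ∈ invD (isolate G {a}) :=
    ⟨_, hf.strip_singleton ha.1, by simp [strip, hf.1.1 a]⟩
  obtain ⟨d, hd, had⟩ := ha.2
  rw [invD_isolate_singleton ha.1 hd had] at h1
  exact h1.resolve_left fun h => ha.1 ⟨f, hf, h⟩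

/-- Each component of the subgraph induced on `D(G)` has exactly one vertex that a given maximum
matching misses or matches to `A(G)`. -/
lemma IsMaxInv.existsUnique_exposed {f : V → V} (hf : IsMaxInv G f)
    (K : (G.induce (invD G)).ConnectedComponent) :
    ∃! x : invD G, (G.induce (invD G)).connectedComponentMk x = K ∧
      (f x = x ∨ f x ∈ invA G) := by
  obtain ⟨hD, hmax⟩ := isolate_of_subset_invA (subset_refl (invA G))
  have hDA (x : invD G) : (x : V) ∉ invA G := fun h => h.1 x.2
  have huniq (g : V → V) (hg : IsMaxInv (isolate G (invA G)) g) (x y : invD G)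
      (hxy : (G.induce (invD G)).Reachable x y) (hx : g x = x) (hy : g y = y) : x = y := by
    let φ : G.induce (invD G) →g
        (isolate G (invA G)).induce (invD (isolate G (invA G))) :=
      ⟨fun z => ⟨z, hD ▸ Or.inl z.2⟩, fun {y z} h => ⟨h, hDA y, hDA z⟩⟩
    have := hg.eq_of_reachable (hxy.map φ) hx hy
    exact Subtype.ext (congrArg (fun z : invD (isolate G (invA G)) => (z : V)) this)
  -- Once `A(G)` is isolated, no edge leaves the vertex set `S` of the component, so every matching
  -- preserves it and parity arguments apply inside `S`.
  let S : Set V := {v | ∃ h : v ∈ invD G, (G.induce (invD G)).connectedComponentMk ⟨v, h⟩ = K}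
  have hclosed (g : V → V) (hg : IsInvMatching (isolate G (invA G)) g) : ∀ x ∈ S, g x ∈ S := by
    rintro x ⟨hx, rfl⟩
    rcases hg.2 x with h | h
    · rw [h]; exact ⟨hx, rfl⟩
    · have hgx : g x ∈ invD G := by
        by_contra hgx
        exact h.2.2 ⟨hgx, x, hx, h.1.symm⟩
      refine ⟨hgx, (SimpleGraph.ConnectedComponent.sound ?_).symm⟩
      exact SimpleGraph.Adj.reachable h.1
  have hone (g : V → V) (hg : IsMaxInv (isolate G (invA G)) g) :
      (fixedPoints g ∩ S).ncard ≤ 1 := by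
    rw [ncard_le_one_iff]
    rintro x y ⟨hx, hxD, hxK⟩ ⟨hy, hyD, hyK⟩
    exact congrArg Subtype.val (huniq g hg ⟨x, hxD⟩ ⟨y, hyD⟩
      (SimpleGraph.ConnectedComponent.exact (hxK.trans hyK.symm)) hx hy)
  -- Some maximum matching misses a vertex of `S`, hence exactly one by Gallai's lemma, so `S` is
  -- odd. Then every maximum matching misses a vertex of `S`.
  have hodd : Odd S.ncard := by
    induction K using SimpleGraph.ConnectedComponent.ind with | _ z =>
    obtain ⟨g, hg, hgz⟩ : (z : V) ∈ invD (isolate G (invA G)) := hD ▸ Or.inl z.2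
    have h1 := even_ncard_add_ncard_fixedPoints hg.1.1 (hclosed g hg.1)
    have h2 := hone g hg
    have h3 : 0 < (fixedPoints g ∩ S).ncard :=
      (ncard_pos).2 ⟨z, hgz, z.2, rfl⟩
    rw [show (fixedPoints g ∩ S).ncard = 1 by omega] at h1
    rw [Nat.even_iff] at h1
    rw [Nat.odd_iff]; omega
  have hf' := hmax f hf
  have hpos : (fixedPoints (strip f (invA G)) ∩ S).Nonempty := by
    rw [← ncard_pos]
    have h1 := even_ncard_add_ncard_fixedPoints hf'.1.1 (hclosed _ hf'.1)
    rw [Nat.even_iff] at h1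
    rw [Nat.odd_iff] at hodd
    omega
  obtain ⟨x, hx, hxD, hxK⟩ := hpos
  have hiff (y : invD G) : strip f (invA G) y = y ↔ f y = y ∨ f y ∈ invA G := by
    rw [strip_eq_self_iff]; simp [hDA y]
  refine ⟨⟨x, hxD⟩, ⟨hxK, (hiff ⟨x, hxD⟩).1 hx⟩, fun y ⟨hyK, hy⟩ => ?_⟩
  exact huniq _ hf' y ⟨x, hxD⟩ (SimpleGraph.ConnectedComponent.exact (hyK.trans hxK.symm))
    ((hiff y).2 hy) hx

end Stability

/-! ### Translation between subgraph matchings and involutions -/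

open Classical in
/-- The involution that exchanges the ends of the edges of a matching. -/
noncomputable def invOf (M : G.Subgraph) (v : V) : V :=
  if h : ∃ w, M.Adj v w then h.choose else v

/-- The matching whose edges join the points exchanged by an involution. -/
def subOf {f : V → V} (hf : IsInvMatching G f) : G.Subgraph where
  verts := {v | f v ≠ v}
  Adj v w := v ≠ w ∧ f v = w
  adj_sub {v _} h := h.2 ▸ (hf.2 v).resolve_left fun h' => h.1 (h'.symm.trans h.2)
  edge_vert h h' := h.1 (h'.symm.trans h.2)
  symm := ⟨fun v _ h => ⟨h.1.symm, h.2 ▸ hf.1 v⟩⟩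

lemma invOf_eq {M : G.Subgraph} (hM : M.IsMatching) {v w : V} (h : M.Adj v w) :
    invOf M v = w := by
  have h' : ∃ w, M.Adj v w := ⟨w, h⟩
  rw [invOf, dif_pos h']
  exact hM.eq_of_adj_left h'.choose_spec h

lemma invOf_eq_self_iff {M : G.Subgraph} (hM : M.IsMatching) {v : V} :
    invOf M v = v ↔ v ∉ M.verts := by
  constructor
  · intro h hv
    obtain ⟨w, hw, -⟩ := hM hv
    rw [invOf_eq hM hw] at h
    exact hw.ne h.symm
  · intro hv
    rw [invOf, dif_neg]
    rintro ⟨w, hw⟩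
    exact hv hw.fst_mem

lemma isInvMatching_invOf {M : G.Subgraph} (hM : M.IsMatching) : IsInvMatching G (invOf M) := by
  have key (v) (hv : v ∈ M.verts) : M.Adj v (invOf M v) := by
    obtain ⟨w, hw, -⟩ := hM hv
    rwa [invOf_eq hM hw]
  refine ⟨fun v => ?_, fun v => ?_⟩ <;> by_cases hv : v ∈ M.verts
  · exact invOf_eq hM (key v hv).symm
  · have := (invOf_eq_self_iff hM).2 hv
    rw [this, this]
  · exact Or.inr (key v hv).adj_sub
  · exact Or.inl ((invOf_eq_self_iff hM).2 hv)

lemma isMatching_subOf {f : V → V} (hf : IsInvMatching G f) : (subOf hf).IsMatching :=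
  fun v hv => ⟨f v, ⟨fun h => hv h.symm, rfl⟩, fun _ h => h.2.symm⟩

/-- Matchings correspond to involutions that move vertices along edges only. -/
noncomputable def matchingEquiv (G : SimpleGraph V) :
    {M : G.Subgraph // M.IsMatching} ≃ {f : V → V // IsInvMatching G f} where
  toFun M := ⟨invOf M.1, isInvMatching_invOf M.2⟩
  invFun f := ⟨subOf f.2, isMatching_subOf f.2⟩
  left_inv M := by
    obtain ⟨M, hM⟩ := M
    apply Subtype.ext
    apply SimpleGraph.Subgraph.ext
    · ext v
      change invOf M v ≠ v ↔ _
      rw [Ne, invOf_eq_self_iff hM, not_not]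
    · ext v w
      change v ≠ w ∧ invOf M v = w ↔ _
      refine ⟨fun ⟨h1, h2⟩ => ?_, fun h => ⟨h.ne, invOf_eq hM h⟩⟩
      have hv : v ∈ M.verts := by
        by_contra hv
        exact h1 (((invOf_eq_self_iff hM).2 hv).symm.trans h2)
      obtain ⟨w', hw', -⟩ := hM hv
      rwa [← h2, invOf_eq hM hw']
  right_inv f := by
    obtain ⟨f, hf⟩ := f
    apply Subtype.ext
    funext v
    change invOf (subOf hf) v = f v
    by_cases hv : f v = v
    · rw [hv, invOf_eq_self_iff (isMatching_subOf hf)]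
      exact fun h => h hv
    · exact invOf_eq (isMatching_subOf hf) ⟨fun h => hv h.symm, rfl⟩

lemma two_mul_ncard_edgeSet [Finite V] {M : G.Subgraph} (hM : M.IsMatching) :
    2 * M.edgeSet.ncard = M.verts.ncard := by
  classical
  have := Fintype.ofFinite V
  have h := M.spanningCoe.sum_degrees_eq_twice_card_edges
  have hdeg (v : V) : M.spanningCoe.degree v = if v ∈ M.verts then 1 else 0 := by
    split_ifs with hv
    · rw [← SimpleGraph.card_neighborSet_eq_degree, Fintype.card_eq_one_iff]
      obtain ⟨w, hw, huniq⟩ := hM hv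
      exact ⟨⟨w, hw⟩, fun y => Subtype.ext (huniq y y.2)⟩
    · rw [SimpleGraph.degree_eq_zero]
      exact fun w hw => hv (M.edge_vert hw)
  rw [Finset.sum_congr rfl fun v _ => hdeg v, Finset.sum_boole] at h
  rw [← M.edgeSet_spanningCoe, ← SimpleGraph.coe_edgeFinset, ncard_coe_finset, ← h,
    ncard_eq_toFinset_card']
  simp [toFinset]

lemma ncard_edgeSet_le_iff [Finite V] {M M' : G.Subgraph} (hM : M.IsMatching)
    (hM' : M'.IsMatching) : M'.edgeSet.ncard ≤ M.edgeSet.ncard ↔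
      (fixedPoints (invOf M)).ncard ≤ (fixedPoints (invOf M')).ncard := by
  have key {M : G.Subgraph} (hM : M.IsMatching) :
      2 * M.edgeSet.ncard + (fixedPoints (invOf M)).ncard = Nat.card V := by
    have : fixedPoints (invOf M) = M.vertsᶜ := by
      ext v; exact invOf_eq_self_iff hM
    rw [two_mul_ncard_edgeSet hM, this, ncard_add_ncard_compl]
  have h1 := key hM
  have h2 := key hM'
  omega

lemma isMaximumMatching_iff [Finite V] {M : G.Subgraph} (hM : M.IsMatching) :
    IsMaximumMatching M ↔ IsMaxInv G (invOf M) := by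
  constructor
  · rintro ⟨-, h⟩
    refine ⟨isInvMatching_invOf hM, fun g hg => ?_⟩
    obtain ⟨⟨M', hM'⟩, h'⟩ := (matchingEquiv G).surjective ⟨g, hg⟩
    obtain rfl : invOf M' = g := Subtype.ext_iff.1 h'
    exact (ncard_edgeSet_le_iff hM hM').1 (h M' hM')
  · rintro ⟨-, h⟩
    exact ⟨hM, fun M' hM' => (ncard_edgeSet_le_iff hM hM').2 (h _ (isInvMatching_invOf hM'))⟩

lemma geD_eq_invD [Finite V] (G : SimpleGraph V) : geD G = invD G := by
  ext v
  constructor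
  · rintro ⟨M, hM, hv⟩
    exact ⟨_, (isMaximumMatching_iff hM.1).1 hM, (invOf_eq_self_iff hM.1).2 hv⟩
  · rintro ⟨f, hf, hv⟩
    obtain ⟨⟨M, hM⟩, h⟩ := (matchingEquiv G).surjective ⟨f, hf.1⟩
    obtain rfl : invOf M = f := Subtype.ext_iff.1 h
    exact ⟨M, (isMaximumMatching_iff hM).2 hf, (invOf_eq_self_iff hM).1 hv⟩

lemma geA_eq_invA [Finite V] (G : SimpleGraph V) : geA G = invA G := by
  simp only [geA, invA, geD_eq_invD]

/-! ### Counting perfect matchings on vertex sets -/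

/-- `f` is a perfect matching of the subgraph induced on `s`, extended by the identity. -/
structure IsPerfectOn (G : SimpleGraph V) (s : Set V) (f : V → V) : Prop where
  involutive : Involutive f
  adj : ∀ v ∈ s, G.Adj v (f v)
  mapsTo : ∀ v ∈ s, f v ∈ s
  eq_self : ∀ v ∉ s, f v = v

/-- The number of perfect matchings of the subgraph induced on `s`. -/
noncomputable def pmOn (G : SimpleGraph V) (s : Set V) : ℕ :=
  Nat.card {f : V → V // IsPerfectOn G s f}

lemma numPM_eq_pmOn_univ (G : SimpleGraph V) : numPM G = pmOn G univ := by
  have e1 : {M : G.Subgraph // M.IsPerfectMatching} ≃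
      {M : {M : G.Subgraph // M.IsMatching} // M.1.IsSpanning} :=
    (Equiv.subtypeSubtypeEquivSubtypeInter _ _).symm
  have e2 : {M : {M : G.Subgraph // M.IsMatching} // M.1.IsSpanning} ≃
      {f : {f : V → V // IsInvMatching G f} // ∀ v, f.1 v ≠ v} :=
    (matchingEquiv G).subtypeEquiv fun M => by
      refine forall_congr' fun v => ?_
      change _ ↔ invOf M.1 v ≠ v
      rw [Ne, invOf_eq_self_iff M.2, not_not]
  have e3 : {f : {f : V → V // IsInvMatching G f} // ∀ v, f.1 v ≠ v} ≃
      {f : V → V // IsPerfectOn G univ f} :=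
    (Equiv.subtypeSubtypeEquivSubtypeInter _ (fun f : V → V => ∀ v, f v ≠ v)).trans
      (Equiv.subtypeEquivRight fun f =>
        ⟨fun h => ⟨h.1.1, fun v _ => (h.1.2 v).resolve_left (h.2 v), by simp, by simp⟩,
          fun h => ⟨⟨h.1, fun v => Or.inr (h.2 v trivial)⟩,
            fun v => (h.2 v trivial).ne'⟩⟩)
  exact Nat.card_congr (e1.trans (e2.trans e3))

/-- This moves counts on nested induced subgraphs to subsets of the one vertex type `V`, where they
can be glued. -/
lemma numPM_eq_pmOn_range {W : Type u} {H : SimpleGraph W} (e : W → V) (he : Injective e)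
    (hadj : ∀ x y, G.Adj (e x) (e y) ↔ H.Adj x y) : numPM H = pmOn G (range e) := by
  rw [numPM_eq_pmOn_univ]
  have hext (g : W → W) (w : W) : extend e (e ∘ g) id (e w) = e (g w) := he.extend_apply _ _ _
  have hext' (g : W → W) (v : V) (hv : v ∉ range e) : extend e (e ∘ g) id v = v :=
    extend_apply' _ _ _ hv
  refine Nat.card_eq_of_bijective
    (fun g : {g : W → W // IsPerfectOn H univ g} =>
      (⟨extend e (e ∘ g.1) id, ?_, ?_, ?_, hext' g.1⟩ : {f : V → V // IsPerfectOn G (range e) f}))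
    ⟨?_, ?_⟩
  · intro v
    by_cases hv : v ∈ range e
    · obtain ⟨w, rfl⟩ := hv
      rw [hext, hext, g.2.involutive]
    · rw [hext' _ _ hv, hext' _ _ hv]
  · rintro _ ⟨w, rfl⟩
    rw [hext, hadj]
    exact g.2.adj w trivial
  · rintro _ ⟨w, rfl⟩
    rw [hext]
    exact ⟨_, rfl⟩
  · rintro ⟨g, hg⟩ ⟨g', hg'⟩ h
    apply Subtype.ext
    funext w
    have := congrFun (Subtype.ext_iff.1 h) (e w)
    simp only [hext] at this
    exact he this
  · rintro ⟨f, hf⟩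
    choose g hg using fun w => hf.mapsTo (e w) ⟨w, rfl⟩
    refine ⟨⟨g, fun w => he ?_, fun w _ => ?_, by simp, by simp⟩, Subtype.ext ?_⟩
    · rw [hg, hg, hf.involutive]
    · rw [← hadj, hg]
      exact hf.adj _ ⟨w, rfl⟩
    · funext v
      by_cases hv : v ∈ range e
      · obtain ⟨w, rfl⟩ := hv
        exact (hext _ _).trans (hg _)
      · exact (hext' _ _ hv).trans (hf.eq_self v hv).symm

open Classical in
lemma pmOn_union {s t : Set V} (hst : Disjoint s t) (hadj : ∀ x ∈ s, ∀ y ∈ t, ¬ G.Adj x y) :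
    pmOn G (s ∪ t) = pmOn G s * pmOn G t := by
  rw [pmOn, pmOn, pmOn, ← Nat.card_prod]
  have hsm {f} (hf : IsPerfectOn G (s ∪ t) f) (x) (hx : x ∈ s) : f x ∈ s :=
    (hf.mapsTo x (Or.inl hx)).resolve_right fun h => hadj _ hx _ h (hf.adj x (Or.inl hx))
  have htm {f} (hf : IsPerfectOn G (s ∪ t) f) (x) (hx : x ∈ t) : f x ∈ t :=
    (hf.mapsTo x (Or.inr hx)).resolve_left fun h => hadj _ h _ hx (hf.adj x (Or.inr hx)).symm
  have restrict {f : V → V} {r : Set V} (hi : Involutive f) (hr : ∀ x ∈ r, f x ∈ r)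
      (ha : ∀ x ∈ r, G.Adj x (f x)) : IsPerfectOn G r (r.piecewise f id) := by
    refine ⟨fun x => ?_, fun x hx => by simpa [hx] using ha x hx,
      fun x hx => by simpa [hx] using hr x hx, fun x hx => by simp [hx]⟩
    by_cases hx : x ∈ r
    · simp [hx, hr x hx, hi x]
    · simp [hx]
  have hts (x) (hx : x ∈ t) : x ∉ s := fun h => Set.disjoint_left.1 hst h hx
  refine Nat.card_congr
    { toFun := fun f => (⟨s.piecewise f.1 id, restrict f.2.1 (hsm f.2)
          fun x hx => f.2.adj x (Or.inl hx)⟩,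
        ⟨t.piecewise f.1 id, restrict f.2.1 (htm f.2) fun x hx => f.2.adj x (Or.inr hx)⟩)
      invFun := fun p => ⟨s.piecewise p.1.1 p.2.1, ?_, ?_, ?_, ?_⟩
      left_inv := ?_
      right_inv := ?_ }
  · intro x
    by_cases hx : x ∈ s
    · simp [hx, p.1.2.mapsTo x hx, p.1.2.involutive x]
    · by_cases hy : x ∈ t
      · simp [hx, hts _ (p.2.2.mapsTo x hy), p.2.2.involutive x]
      · simp [hx, p.2.2.eq_self x hy]
  · rintro x hx
    by_cases hxs : x ∈ s
    · simpa [hxs] using p.1.2.adj x hxs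
    · simpa [hxs] using p.2.2.adj x (hx.resolve_left hxs)
  · rintro x hx
    by_cases hxs : x ∈ s
    · simpa [hxs] using Or.inl (p.1.2.mapsTo x hxs)
    · simpa [hxs] using Or.inr (p.2.2.mapsTo x (hx.resolve_left hxs))
  · rintro x hx
    rw [mem_union, not_or] at hx
    simpa [hx.1] using p.2.2.eq_self x hx.2
  · rintro ⟨f, hf⟩
    apply Subtype.ext
    funext x
    by_cases hx : x ∈ s
    · simp [hx]
    · by_cases hy : x ∈ t
      · simp [hx, hy]
      · simp [hx, hy, hf.eq_self x (by simp [hx, hy])]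
  · rintro ⟨⟨f, hf⟩, ⟨g, hg⟩⟩
    refine Prod.ext (Subtype.ext ?_) (Subtype.ext ?_)
    · funext x
      by_cases hx : x ∈ s
      · simp [hx]
      · simp [hx, hf.eq_self x hx]
    · funext x
      by_cases hx : x ∈ t
      · simp [hx, hts x hx]
      · simp [hx, hg.eq_self x hx]

lemma pmOn_empty (G : SimpleGraph V) : pmOn G ∅ = 1 := by
  rw [pmOn, Nat.card_eq_one_iff_unique]
  refine ⟨⟨fun f g => Subtype.ext (funext fun v => ?_)⟩,
    ⟨⟨id, fun _ => rfl, by simp, by simp, fun _ _ => rfl⟩⟩⟩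
  rw [f.2.eq_self v (by simp), g.2.eq_self v (by simp)]

lemma pmOn_iUnion {ι : Type*} [Fintype ι] {s : ι → Set V}
    (hs : Pairwise fun i j => Disjoint (s i) (s j))
    (hadj : ∀ i j, i ≠ j → ∀ x ∈ s i, ∀ y ∈ s j, ¬ G.Adj x y) :
    pmOn G (⋃ i, s i) = ∏ i, pmOn G (s i) := by
  classical
  suffices h : ∀ t : Finset ι, pmOn G (⋃ i ∈ t, s i) = ∏ i ∈ t, pmOn G (s i) by
    simpa using h Finset.univ
  intro t
  induction t using Finset.induction_on with
  | empty => simp [pmOn_empty]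
  | insert a t ha ih =>
    rw [Finset.prod_insert ha, ← ih, Finset.set_biUnion_insert, pmOn_union]
    · rw [Set.disjoint_iUnion₂_right]
      exact fun i hi => hs (by rintro rfl; exact ha hi)
    · intro x hx y hy
      obtain ⟨i, hi, hy⟩ := mem_iUnion₂.1 hy
      exact hadj a i (by rintro rfl; exact ha hi) x hx y hy

lemma existsUnique_exposed [Finite V] {f : V → V} (hf : IsMaxInv G f)
    (K : (G.induce (geD G)).ConnectedComponent) :
    ∃! x : geD G, (G.induce (geD G)).connectedComponentMk x = K ∧ (f x = x ∨ f x ∈ geA G) := by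
  -- The type of `K` depends on `D`, so the sets are made variables before the equalities are
  -- substituted.
  have key : ∀ D, D = invD G → ∀ A, A = invA G → ∀ K : (G.induce D).ConnectedComponent,
      ∃! x : D, (G.induce D).connectedComponentMk x = K ∧ (f x = x ∨ f x ∈ A) := by
    rintro _ rfl _ rfl K
    exact hf.existsUnique_exposed K
  exact key _ (geD_eq_invD G) _ (geA_eq_invA G) K

/-- The component of `D(G - u)` containing `d`. -/
abbrev comp (G : SimpleGraph V) (u : V) (d : geD (del G u)) : rightSide G u :=
  (dGraph G u).connectedComponentMk d

/-! ### Perfect matchings of `G` seen in `G - u` -/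

section Restrict

variable (u : V) {F : V → V}

open Classical in
/-- The restriction of a perfect matching of `G` to `G - u`. -/
noncomputable def restrictDel (F : V → V) (w : ({u}ᶜ : Set V)) : ({u}ᶜ : Set V) :=
  if h : F w = u then w else ⟨F w, h⟩

variable {u}

lemma restrictDel_of_eq {w : ({u}ᶜ : Set V)} (h : F w = u) : restrictDel u F w = w := dif_pos h

lemma coe_restrictDel_of_ne {w : ({u}ᶜ : Set V)} (h : F w ≠ u) :
    (restrictDel u F w : V) = F w := by
  rw [restrictDel, dif_neg h]

variable (hF : IsPerfectOn G univ F)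
include hF

lemma IsPerfectOn.apply_ne (v : V) : F v ≠ v := (hF.adj v trivial).ne'

lemma restrictDel_eq_self_iff {w : ({u}ᶜ : Set V)} : restrictDel u F w = w ↔ F w = u := by
  refine ⟨fun h => ?_, restrictDel_of_eq⟩
  by_contra h'
  have := coe_restrictDel_of_ne h'
  rw [h] at this
  exact hF.apply_ne w this.symm

lemma isInvMatching_restrictDel : IsInvMatching (del G u) (restrictDel u F) := by
  refine ⟨fun w => ?_, fun w => ?_⟩ <;> by_cases h : F w = u
  · rw [restrictDel_of_eq h, restrictDel_of_eq h]
  · apply Subtype.ext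
    have h1 := coe_restrictDel_of_ne h
    have h2 : F (restrictDel u F w) = w := by rw [h1, hF.involutive]
    rw [coe_restrictDel_of_ne (by rw [h2]; exact w.2), h2]
  · exact Or.inl (restrictDel_of_eq h)
  · right
    rw [SimpleGraph.comap_adj]
    change G.Adj w (restrictDel u F w)
    rw [coe_restrictDel_of_ne h]
    exact hF.adj w trivial

/-- Only the partner of `u` is missed, and parity forbids a matching of `G - u` that misses nothing.
-/
lemma isMaxInv_restrictDel [Finite V] : IsMaxInv (del G u) (restrictDel u F) := by
  have hfix : fixedPoints (restrictDel u F) = {⟨F u, hF.apply_ne u⟩} := by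
    ext w
    rw [mem_fixedPoints, IsFixedPt, restrictDel_eq_self_iff hF, mem_singleton_iff,
      Subtype.ext_iff]
    exact hF.involutive.eq_iff
  refine ⟨isInvMatching_restrictDel hF, fun g hg => ?_⟩
  have := even_ncard_fixedPoints_add (isInvMatching_restrictDel (u := u) hF).1 hg.1
  rw [hfix, ncard_singleton] at *
  rw [Nat.even_iff] at this
  omega

/-- A perfect matching of `G` matches the vertices of `A(G - u) ∪ {u}` into `D(G - u)`. -/
lemma IsPerfectOn.exists_of_mem_leftSide [Finite V] {x : V} (hx : x ∈ leftSide G u) :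
    ∃ d : geD (del G u), (d.1.1 : V) = F x := by
  have hmax := isMaxInv_restrictDel (u := u) hF
  rcases hx with rfl | ⟨a, ha, rfl⟩
  · refine ⟨⟨⟨F x, hF.apply_ne x⟩, ?_⟩, rfl⟩
    rw [geD_eq_invD]
    exact ⟨_, hmax, restrictDel_of_eq (hF.involutive x)⟩
  · have hFa : F a ≠ u := fun h => by
      refine ha.1 ?_
      rw [geD_eq_invD]
      exact ⟨_, hmax, restrictDel_of_eq h⟩
    rw [geA_eq_invA] at ha
    refine ⟨⟨restrictDel u F a, ?_⟩, coe_restrictDel_of_ne hFa⟩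
    rw [geD_eq_invD]
    exact hmax.apply_mem_invD ha

lemma IsPerfectOn.mem_leftSide_iff {d : geD (del G u)} :
    F d.1.1 ∈ leftSide G u ↔ restrictDel u F d.1 = d.1 ∨ restrictDel u F d.1 ∈ geA (del G u) := by
  rw [restrictDel_eq_self_iff hF, leftSide, mem_insert_iff]
  by_cases h : F d.1.1 = u
  · simp [h]
  · rw [or_iff_right h, or_iff_right h]
    have h1 := coe_restrictDel_of_ne h
    constructor
    · rintro ⟨a, ha, hae⟩
      rwa [show restrictDel u F d.1 = a from Subtype.ext (h1.trans hae.symm)]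
    · exact fun ha => ⟨_, ha, h1⟩

/-- A perfect matching of `G` has exactly one edge between each component of `D(G - u)` and
`A(G - u) ∪ {u}`. -/
lemma IsPerfectOn.existsUnique_mem_leftSide [Finite V] (K : rightSide G u) :
    ∃! d : geD (del G u), comp G u d = K ∧ F d.1.1 ∈ leftSide G u := by
  simp only [hF.mem_leftSide_iff]
  exact existsUnique_exposed (isMaxInv_restrictDel hF) K

end Restrict

/-! ### The counting identity -/

/-- An assignment of neighbours in `D(G - u)` to the vertices of `A(G - u) ∪ {u}`, one in each
component. -/
def IsGood (G : SimpleGraph V) (u : V) (τ : leftSide G u → geD (del G u)) : Prop :=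
  (∀ x : leftSide G u, G.Adj x (τ x).1.1) ∧ Bijective fun x => comp G u (τ x)

lemma IsPerfectOn.exists_isGood [Finite V] {u : V} {F : V → V} (hF : IsPerfectOn G univ F) :
    ∃ τ, IsGood G u τ ∧ ∀ x, ((τ x).1.1 : V) = F x := by
  choose τ hτ using fun x : leftSide G u => hF.exists_of_mem_leftSide x.2
  refine ⟨τ, ⟨fun x => by rw [hτ]; exact hF.adj _ trivial, ?_, ?_⟩, hτ⟩
  · intro x y hxy
    have key (x) : F (τ x).1.1 = x := by rw [hτ, hF.involutive]
    have := (hF.existsUnique_mem_leftSide (comp G u (τ x))).unique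
      ⟨rfl, by rw [key]; exact x.2⟩ ⟨hxy.symm, by rw [key]; exact y.2⟩
    apply Subtype.ext
    rw [← key x, this, key]
  · intro K
    obtain ⟨d, ⟨hd, hdF⟩, -⟩ := hF.existsUnique_mem_leftSide K
    refine ⟨⟨F d.1.1, hdF⟩, ?_⟩
    rw [← hd]
    change comp G u _ = _
    congr 1
    apply Subtype.ext
    apply Subtype.ext
    rw [hτ, hF.involutive]

/-- The vertices of `H_d - d` in `G`. -/
def hSet (G : SimpleGraph V) (u : V) (d : geD (del G u)) : Set V :=
  {v | ∃ e : geD (del G u), comp G u e = comp G u d ∧ e ≠ d ∧ (e.1.1 : V) = v}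

/-- The vertices of `C(G - u)` in `G`. -/
def cSet (G : SimpleGraph V) (u : V) : Set V := {v | ∃ c ∈ geC (del G u), (c.1 : V) = v}

lemma numPM_hGraph (u : V) (d : geD (del G u)) : numPM (hGraph G u d) = pmOn G (hSet G u d) := by
  rw [numPM_eq_pmOn_range (G := G) (fun e => e.1.1.1)
    (fun e e' h => Subtype.ext (Subtype.ext (Subtype.ext h))) fun _ _ => Iff.rfl]
  congr 1
  ext v
  constructor
  · rintro ⟨⟨e, he, hne⟩, rfl⟩
    exact ⟨e, he, hne, rfl⟩
  · rintro ⟨e, he, hne, rfl⟩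
    exact ⟨⟨e, he, hne⟩, rfl⟩

lemma numPM_cGraph (u : V) : numPM (cGraph G u) = pmOn G (cSet G u) := by
  rw [numPM_eq_pmOn_range (G := G) (fun e => e.1.1)
    (fun e e' h => Subtype.ext (Subtype.ext h)) fun _ _ => Iff.rfl]
  congr 1
  ext v
  constructor
  · rintro ⟨⟨e, he⟩, rfl⟩
    exact ⟨e, he, rfl⟩
  · rintro ⟨e, he, rfl⟩
    exact ⟨⟨e, he⟩, rfl⟩

/-- The vertices of `G` outside the edges `x τ(x)`. -/
def restSet (G : SimpleGraph V) (u : V) (τ : leftSide G u → geD (del G u)) : Set V :=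
  {v | v ∉ leftSide G u ∧ ∀ x, (τ x).1.1 ≠ v}

lemma coe_notMem_leftSide {u : V} (d : geD (del G u)) : (d.1.1 : V) ∉ leftSide G u := by
  rintro (h | ⟨a, ha, h⟩)
  · exact d.1.2 h
  · exact ha.1 (Subtype.ext h ▸ d.2)

lemma restSet_eq {u : V} {τ : leftSide G u → geD (del G u)} (hτ : IsGood G u τ) :
    restSet G u τ = cSet G u ∪ ⋃ x, hSet G u (τ x) := by
  ext v
  constructor
  · rintro ⟨hvX, hvτ⟩
    have hvu : v ≠ u := fun h => hvX (Or.inl h)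
    by_cases hvD : (⟨v, hvu⟩ : ({u}ᶜ : Set V)) ∈ geD (del G u)
    · right
      obtain ⟨x, hx⟩ := hτ.2.2 (comp G u ⟨_, hvD⟩)
      refine mem_iUnion.2 ⟨x, ⟨_, hvD⟩, hx.symm, ?_, rfl⟩
      rintro h
      exact hvτ x (by rw [← h])
    · left
      exact ⟨_, ⟨hvD, fun h => hvX (Or.inr ⟨_, h, rfl⟩)⟩, rfl⟩
  · rintro (⟨c, hc, rfl⟩ | h)
    · refine ⟨?_, fun x h => hc.1 (Subtype.ext h ▸ (τ x).2)⟩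
      rintro (h | ⟨a, ha, h⟩)
      · exact c.2 h
      · exact hc.2 (Subtype.ext h ▸ ha)
    · obtain ⟨x, e, he, hne, rfl⟩ := mem_iUnion.1 h
      refine ⟨coe_notMem_leftSide e, fun y hy => hne ?_⟩
      have hye : τ y = e := Subtype.ext (Subtype.ext hy)
      rw [← hye] at he ⊢
      rw [hτ.2.1 he]

/-- The count factors because distinct components of `D(G - u)` are not joined, and an edge from
`C(G - u)` to `D(G - u)` would put its end into `A(G - u)`. -/
lemma pmOn_restSet {u : V} [Fintype (leftSide G u)] {τ : leftSide G u → geD (del G u)}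
    (hτ : IsGood G u τ) :
    pmOn G (restSet G u τ) = numPM (cGraph G u) * ∏ x, numPM (hGraph G u (τ x)) := by
  rw [restSet_eq hτ, pmOn_union, pmOn_iUnion, numPM_cGraph]
  · simp only [numPM_hGraph]
  · intro x y hxy
    rw [Set.disjoint_left]
    rintro _ ⟨e, he, -, rfl⟩ ⟨e', he', -, h⟩
    obtain rfl : e' = e := Subtype.ext (Subtype.ext h)
    exact hxy (hτ.2.1 (he.symm.trans he'))
  · rintro x y hxy _ ⟨e, he, -, rfl⟩ _ ⟨e', he', -, rfl⟩ h
    have : comp G u e = comp G u e' :=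
      SimpleGraph.ConnectedComponent.sound (SimpleGraph.Adj.reachable h)
    exact hxy (hτ.2.1 (he.symm.trans (this.trans he')))
  · rw [Set.disjoint_left]
    rintro _ ⟨c, hc, rfl⟩ h
    obtain ⟨x, e, -, -, h⟩ := mem_iUnion.1 h
    exact hc.1 (Subtype.ext h ▸ e.2)
  · rintro _ ⟨c, hc, rfl⟩ _ hy h
    obtain ⟨x, e, -, -, rfl⟩ := mem_iUnion.1 hy
    exact hc.2 ⟨hc.1, e.1, e.2, h⟩

-- On `X` and `τ(X)` such an `F` is forced to exchange `x` and `τ x`; on the rest it is arbitrary.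
open Classical in
lemma card_perfectOn_eq_pmOn_restSet {u : V} {τ : leftSide G u → geD (del G u)}
    (hτ : IsGood G u τ) :
    Nat.card {F : V → V // IsPerfectOn G univ F ∧ ∀ x, ((τ x).1.1 : V) = F x} =
      pmOn G (restSet G u τ) := by
  have hτi : Injective τ := fun x y h => hτ.2.1 (congrArg (comp G u) h)
  have hcoe (x y) : ((τ x).1.1 : V) = (τ y).1.1 ↔ x = y :=
    ⟨fun h => hτi (Subtype.ext (Subtype.ext h)), fun h => by rw [h]⟩
  have hrest {F : V → V} (hF : IsPerfectOn G univ F) (hFτ : ∀ x, ((τ x).1.1 : V) = F x) :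
      ∀ v ∈ restSet G u τ, F v ∈ restSet G u τ := by
    rintro v ⟨h1, h2⟩
    refine ⟨fun h => h2 ⟨_, h⟩ ?_, fun x h => h1 ?_⟩
    · rw [hFτ, hF.involutive]
    · rw [hFτ] at h
      rw [← hF.involutive.injective h]
      exact x.2
  -- the involution exchanging `x` and `τ x`
  let T : V → V := fun v =>
    if h : v ∈ leftSide G u then (τ ⟨v, h⟩).1.1
    else if h : ∃ x, ((τ x).1.1 : V) = v then h.choose else v
  have hT1 (x : leftSide G u) : T x = (τ x).1.1 := by simp only [T, dif_pos x.2]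
  have hT2 (x : leftSide G u) : T (τ x).1.1 = x := by
    have h : ∃ y, ((τ y).1.1 : V) = (τ x).1.1 := ⟨x, rfl⟩
    simp only [T, dif_neg (coe_notMem_leftSide (τ x))]
    rw [dif_pos h]
    exact congrArg Subtype.val ((hcoe _ _).1 h.choose_spec)
  have hcases (v : V) (hv : v ∉ restSet G u τ) :
      (∃ x : leftSide G u, x.1 = v) ∨ ∃ x, ((τ x).1.1 : V) = v := by
    by_contra! h
    exact hv ⟨fun hx => h.1 ⟨v, hx⟩ rfl, h.2⟩
  have hX (x : leftSide G u) : x.1 ∉ restSet G u τ := fun h => h.1 x.2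
  have hτR (x : leftSide G u) : (τ x).1.1 ∉ restSet G u τ := fun h => h.2 x rfl
  refine Nat.card_congr
    { toFun := fun F => ⟨(restSet G u τ).piecewise F.1 id, ?_, ?_, ?_, ?_⟩
      invFun := fun f => ⟨(restSet G u τ).piecewise f.1 T, ⟨?_, ?_, by simp, by simp⟩, ?_⟩
      left_inv := ?_
      right_inv := ?_ }
  · intro v
    by_cases hv : v ∈ restSet G u τ
    · simp [hv, hrest F.2.1 F.2.2 v hv, F.2.1.involutive v]
    · simp [hv]
  · intro v hv
    simpa [hv] using F.2.1.adj v trivial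
  · intro v hv
    simpa [hv] using hrest F.2.1 F.2.2 v hv
  · intro v hv
    simp [hv]
  · intro v
    by_cases hv : v ∈ restSet G u τ
    · simp [hv, f.2.mapsTo v hv, f.2.involutive v]
    · rcases hcases v hv with ⟨x, rfl⟩ | ⟨x, rfl⟩
      · rw [piecewise_eq_of_notMem _ _ _ (hX x), hT1, piecewise_eq_of_notMem _ _ _ (hτR x), hT2]
      · rw [piecewise_eq_of_notMem _ _ _ (hτR x), hT2, piecewise_eq_of_notMem _ _ _ (hX x), hT1]
  · intro v _
    by_cases hv : v ∈ restSet G u τ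
    · simpa [hv] using f.2.adj v hv
    · rcases hcases v hv with ⟨x, rfl⟩ | ⟨x, rfl⟩
      · rw [piecewise_eq_of_notMem _ _ _ (hX x), hT1]
        exact hτ.1 x
      · rw [piecewise_eq_of_notMem _ _ _ (hτR x), hT2]
        exact (hτ.1 x).symm
  · intro x
    rw [piecewise_eq_of_notMem _ _ _ (hX x), hT1]
  · rintro ⟨F, hF, hFτ⟩
    apply Subtype.ext
    funext v
    by_cases hv : v ∈ restSet G u τ
    · simp [hv]
    · change (restSet G u τ).piecewise _ T v = F v
      rcases hcases v hv with ⟨x, rfl⟩ | ⟨x, rfl⟩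
      · rw [piecewise_eq_of_notMem _ _ _ (hX x), hT1, hFτ]
      · rw [piecewise_eq_of_notMem _ _ _ (hτR x), hT2, hFτ, hF.involutive]
  · rintro ⟨f, hf⟩
    apply Subtype.ext
    funext v
    by_cases hv : v ∈ restSet G u τ
    · simp [hv]
    · simp [hv, hf.eq_self v hv]

open Classical in
/-- The number of perfect matchings of `G`, sorted by the edges at `A(G - u) ∪ {u}`. -/
lemma numPM_eq_sum [Finite V] (u : V) [Fintype (leftSide G u)]
    [Fintype (leftSide G u → geD (del G u))] :
    numPM G = numPM (cGraph G u) *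
      ∑ τ with IsGood G u τ, ∏ x, numPM (hGraph G u (τ x)) := by
  have e : {F : V → V // IsPerfectOn G univ F} ≃ Σ τ : {τ // IsGood G u τ},
      {F : V → V // IsPerfectOn G univ F ∧ ∀ x, ((τ.1 x).1.1 : V) = F x} :=
    (Equiv.ofBijective (fun p => ⟨p.2.1, p.2.2.1⟩) ⟨by
      rintro ⟨⟨τ, hτ⟩, ⟨F, hF, hFτ⟩⟩ ⟨⟨τ', hτ'⟩, ⟨F', hF', hFτ'⟩⟩ h
      obtain rfl : F = F' := Subtype.ext_iff.1 h
      obtain rfl : τ = τ' := funext fun x =>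
        Subtype.ext (Subtype.ext ((hFτ x).trans (hFτ' x).symm))
      rfl, by
      rintro ⟨F, hF⟩
      obtain ⟨τ, hτ, hFτ⟩ := hF.exists_isGood (u := u)
      exact ⟨⟨⟨τ, hτ⟩, ⟨F, hF, hFτ⟩⟩, rfl⟩⟩).symm
  rw [numPM_eq_pmOn_univ, pmOn, Nat.card_congr e, Nat.card_sigma, Finset.mul_sum,
    Finset.sum_subtype (p := IsGood G u) _ (by simp)]
  exact Finset.sum_congr rfl fun τ _ => by
    rw [card_perfectOn_eq_pmOn_restSet τ.2, pmOn_restSet τ.2]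

open Classical in
lemma weight_eq_sum {u : V} [Fintype (geD (del G u))] (m : geD (del G u) → ℝ)
    (x : leftSide G u) (H : rightSide G u) :
    weight G u m x H =
      ∑ d, if comp G u d = H ∧ G.Adj x d.1.1 then m d else 0 := by
  rw [weight, finsum_eq_sum_of_fintype]
  exact Finset.sum_congr rfl fun d _ => finsum_eq_if

open Classical in
/-- The permanent of the weighted bipartite graph as a sum over assignments of neighbours. -/
lemma permanent_weight_eq_sum [Finite V] (u : V) [Fintype (leftSide G u)]
    [Fintype (leftSide G u → geD (del G u))] (m : geD (del G u) → ℝ) :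
    permanent (weight G u m) = ∑ τ with IsGood G u τ, ∏ x, m (τ x) := by
  have := Fintype.ofFinite (geD (del G u))
  have := Fintype.ofFinite (rightSide G u)
  have h1 (σ : leftSide G u ≃ rightSide G u) : ∏ᶠ x, weight G u m x (σ x) =
      ∑ τ : leftSide G u → geD (del G u),
        if ∀ x, comp G u (τ x) = σ x ∧ G.Adj x (τ x).1.1 then ∏ x, m (τ x) else 0 := by
    rw [finprod_eq_prod_of_fintype]
    simp only [weight_eq_sum]
    rw [Finset.prod_univ_sum, Fintype.piFinset_univ]
    refine Finset.sum_congr (by congr!) fun τ _ => ?_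
    rw [Finset.prod_ite_zero]
    simp
  rw [permanent, finsum_eq_sum_of_fintype]
  simp only [h1]
  rw [Finset.sum_comm, Finset.sum_filter]
  refine Finset.sum_congr rfl fun τ _ => ?_
  split_ifs with hτ
  -- A good `τ` is compatible with exactly one bijection `σ`, the one it induces on components.
  · rw [Finset.sum_eq_single (Equiv.ofBijective _ hτ.2)]
    · rw [if_pos]
      exact fun x => ⟨rfl, hτ.1 x⟩
    · intro σ _ hσ
      rw [if_neg]
      exact fun h => hσ (Equiv.ext fun x => (h x).1.symm)
    · simp
  · refine Finset.sum_eq_zero fun σ _ => if_neg fun h => hτ ⟨fun x => (h x).2, ?_⟩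
    rw [show (fun x => comp G u (τ x)) = σ from funext fun x => (h x).1]
    exact σ.bijective

/-- The number of perfect matchings of `G` from those of the pieces of the decomposition of
`G - u`. -/
theorem numPM_mul_permanent [Finite V] (u : V) :
    (numPM (cGraph G u) : ℝ) * permanent (weight G u fun v => (numPM (hGraph G u v) : ℝ)) =
      numPM G := by
  classical
  have := Fintype.ofFinite (leftSide G u)
  have := Fintype.ofFinite (leftSide G u → geD (del G u))
  rw [permanent_weight_eq_sum, numPM_eq_sum (G := G) u]
  push_cast
  rfl

/-! ### Error analysis -/

/-- At most a third of the vertices serve to join `A(G - u) ∪ {u}` to components of `D(G - u)`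
with more than one vertex. -/
lemma IsGood.three_mul_card_le [Finite V] {u : V} [Fintype (leftSide G u)]
    {τ : leftSide G u → geD (del G u)} (hτ : IsGood G u τ) (s : Finset (leftSide G u))
    (hs : ∀ x ∈ s, ∃ e, comp G u e = comp G u (τ x) ∧ e ≠ τ x) :
    3 * s.card ≤ Nat.card V := by
  classical
  choose e he hne using hs
  -- The three vertices are `x`, `τ x` and another vertex of the same component. They are distinct
  -- for different `x` because `X` avoids `D(G - u)` and `τ` hits each component once.
  let φ : Fin 3 × s → V := fun p => ![(p.2.1 : V), (τ p.2.1).1.1, (e p.2.1 p.2.2).1.1] p.1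
  have hinj {d d' : geD (del G u)} (h : (d.1.1 : V) = d'.1.1) : d = d' :=
    Subtype.ext (Subtype.ext h)
  have hX (x : leftSide G u) (d : geD (del G u)) : (x : V) ≠ d.1.1 := fun h =>
    coe_notMem_leftSide d (h ▸ x.2)
  have hφ : Injective φ := by
    rintro ⟨i, x, hx⟩ ⟨j, y, hy⟩ h
    have hcx := he x hx
    have hcy := he y hy
    have key : i = j ∧ x = y := by
      fin_cases i <;> fin_cases j <;> simp [φ] at h ⊢
      · exact Subtype.ext h
      · exact hX _ _ h
      · exact hX _ _ h
      · exact hX _ _ h.symm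
      · exact hτ.2.1 (congrArg (comp G u) (hinj h))
      · have h' := hinj h
        have hxy : x = y := hτ.2.1 ((congrArg (comp G u) h').trans hcy)
        subst hxy
        exact hne x hx h'.symm
      · exact hX _ _ h.symm
      · have h' := hinj h
        have hxy : x = y := hτ.2.1 (hcx.symm.trans (congrArg (comp G u) h'))
        subst hxy
        exact hne x hx h'
      · have h' := hinj h
        exact hτ.2.1 (hcx.symm.trans (h' ▸ hcy))
    obtain ⟨rfl, rfl⟩ := key
    rfl
  have := Nat.card_le_card_of_injective φ hφ
  simpa using this

lemma numPM_of_isEmpty [IsEmpty V] (G : SimpleGraph V) : numPM G = 1 := by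
  rw [numPM_eq_pmOn_univ, univ_eq_empty_iff.2 ‹_›, pmOn_empty]

lemma Returns.eq_one {P : Subroutine.{u}} {U : ChoiceRule.{u}} [hV : IsEmpty V] {ε r : ℝ}
    (h : Returns P U G ε r) : r = 1 := by
  cases h with
  | empty => rfl
  | step _ _ u => exact hV.elim u

/-- By convexity the exponential lies below its chord on `[0, 2/3]`, and `exp (2/3) ≤ 2` since `e² ≤
8`. -/
lemma exp_two_thirds_mul_le {ε : ℝ} (h0 : 0 ≤ ε) (h1 : ε ≤ 1) : Real.exp (2 / 3 * ε) ≤ 1 + ε := by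
  have hc := convexOn_exp.2 (mem_univ 0) (mem_univ (2 / 3)) (sub_nonneg.2 h1) h0 (by ring)
  have he : Real.exp (2 / 3) ≤ 2 := by
    have h2 : Real.exp (2 / 3) ^ 3 ≤ 2 ^ 3 := by
      rw [← Real.exp_nat_mul]
      norm_num
      have h3 : Real.exp 2 = Real.exp 1 * Real.exp 1 := by rw [← Real.exp_add]; norm_num
      have := Real.exp_one_lt_d9
      have := Real.exp_pos 1
      nlinarith
    exact le_of_pow_le_pow_left₀ (by norm_num) (by norm_num) h2
  simp only [smul_eq_mul, mul_zero, zero_add, Real.exp_zero, mul_one] at hc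
  rw [mul_comm] at hc
  nlinarith

section Error

variable [Finite V] {u : V} {ε : ℝ} {m : geD (del G u) → ℝ}

/-- The estimates in a product over a good assignment: only the vertices joined to components
with more than one vertex contribute an error. -/
lemma IsGood.prod_bounds [Fintype (leftSide G u)] {τ : leftSide G u → geD (del G u)}
    (hτ : IsGood G u τ) (h0 : 0 < ε) (h1 : ε ≤ 1)
    (hone : ∀ d, (∀ e, comp G u e = comp G u d → e = d) → m d = numPM (hGraph G u d))
    (hlow : ∀ d, (1 - ε / (2 * Nat.card V)) * numPM (hGraph G u d) ≤ m d)
    (hup : ∀ d, m d ≤ Real.exp (2 / 3 * (ε / (2 * Nat.card V))) * numPM (hGraph G u d)) :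
    (1 - ε / 6) * ∏ x, (numPM (hGraph G u (τ x)) : ℝ) ≤ ∏ x, m (τ x) ∧
      ∏ x, m (τ x) ≤ Real.exp (ε / 9) * ∏ x, (numPM (hGraph G u (τ x)) : ℝ) := by
  classical
  have hn : (1 : ℝ) ≤ Nat.card V := by
    have : Nonempty V := ⟨u⟩
    exact_mod_cast Nat.card_pos
  have hthird {s : Finset (leftSide G u)}
      (hs : ∀ x ∈ s, ∃ e, comp G u e = comp G u (τ x) ∧ e ≠ τ x) :
      3 * (s.card : ℝ) ≤ Nat.card V := by
    exact_mod_cast hτ.three_mul_card_le s hs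
  generalize (Nat.card V : ℝ) = n at *
  have hδ0 : 0 < ε / (2 * n) := by positivity
  have hδ1 : ε / (2 * n) ≤ 1 := by
    rw [div_le_one (by positivity)]; linarith
  let s : Finset (leftSide G u) :=
    Finset.univ.filter fun x => ∃ e, comp G u e = comp G u (τ x) ∧ e ≠ τ x
  have hs : 3 * (s.card : ℝ) ≤ n := hthird (by simp [s])
  have hex (x) (hx : x ∉ s) : m (τ x) = numPM (hGraph G u (τ x)) := by
    refine hone _ fun e he => ?_
    by_contra hne
    exact hx (by simp only [s, Finset.mem_filter_univ]; exact ⟨e, he, hne⟩)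
  have hprod (c : ℝ) : c ^ s.card * ∏ x, (numPM (hGraph G u (τ x)) : ℝ) =
      ∏ x, ((if x ∈ s then c else 1) * (numPM (hGraph G u (τ x)) : ℝ)) := by
    rw [Finset.prod_mul_distrib, Finset.prod_ite_mem]
    simp
  have hpos : (0 : ℝ) ≤ ∏ x, (numPM (hGraph G u (τ x)) : ℝ) :=
    Finset.prod_nonneg fun _ _ => Nat.cast_nonneg _
  have hm (d) : 0 ≤ m d := le_trans (mul_nonneg (by linarith) (Nat.cast_nonneg _)) (hlow d)
  -- With at most `n/3` inexact factors of accuracy `ε/(2n)`, the total is `ε/6`. Bernoulli's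
  -- inequality turns it into the lower factor `1 - ε/6`, and `2/3` of it is the exponent `ε/9`.
  have hfrac : s.card * (ε / (2 * n)) ≤ ε / 6 := by
    rw [← mul_div_assoc, div_le_iff₀ (by positivity)]
    nlinarith
  constructor
  · calc _ ≤ (1 - ε / (2 * n)) ^ s.card * ∏ x, (numPM (hGraph G u (τ x)) : ℝ) := by
          refine mul_le_mul_of_nonneg_right ?_ hpos
          have := one_add_mul_le_pow (a := -(ε / (2 * n))) (by linarith) s.card
          rw [← sub_eq_add_neg] at this
          linarith
      _ ≤ _ := by
          rw [hprod]
          refine Finset.prod_le_prod (fun x _ => ?_) fun x _ => ?_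
          · refine mul_nonneg ?_ (Nat.cast_nonneg _)
            split_ifs <;> linarith
          · split_ifs with hx
            · exact hlow _
            · rw [one_mul, hex x hx]
  · calc _ ≤ Real.exp (2 / 3 * (ε / (2 * n))) ^ s.card *
            ∏ x, (numPM (hGraph G u (τ x)) : ℝ) := by
          rw [hprod]
          refine Finset.prod_le_prod (fun x _ => hm _) fun x _ => ?_
          split_ifs with hx
          · exact hup _
          · rw [one_mul, hex x hx]
      _ ≤ _ := by
          refine mul_le_mul_of_nonneg_right ?_ hpos
          rw [← Real.exp_nat_mul, Real.exp_le_exp]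
          linarith

lemma permanent_bounds (h0 : 0 < ε) (h1 : ε ≤ 1)
    (hone : ∀ d, (∀ e, comp G u e = comp G u d → e = d) → m d = numPM (hGraph G u d))
    (hlow : ∀ d, (1 - ε / (2 * Nat.card V)) * numPM (hGraph G u d) ≤ m d)
    (hup : ∀ d, m d ≤ Real.exp (2 / 3 * (ε / (2 * Nat.card V))) * numPM (hGraph G u d)) :
    (1 - ε / 6) * permanent (weight G u fun v => (numPM (hGraph G u v) : ℝ)) ≤
        permanent (weight G u m) ∧
      permanent (weight G u m) ≤
        Real.exp (ε / 9) * permanent (weight G u fun v => (numPM (hGraph G u v) : ℝ)) := by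
  classical
  have := Fintype.ofFinite (leftSide G u)
  have := Fintype.ofFinite (leftSide G u → geD (del G u))
  simp only [permanent_weight_eq_sum, Finset.mul_sum]
  exact ⟨Finset.sum_le_sum fun τ hτ =>
      ((Finset.mem_filter.1 hτ).2.prod_bounds h0 h1 hone hlow hup).1,
    Finset.sum_le_sum fun τ hτ =>
      ((Finset.mem_filter.1 hτ).2.prod_bounds h0 h1 hone hlow hup).2⟩

end Error

lemma permanent_nonneg {X Y : Type u} {w : X → Y → ℝ} (hw : ∀ x y, 0 ≤ w x y) :
    0 ≤ permanent w :=
  finsum_nonneg fun _ => finprod_nonneg fun _ => hw _ _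

lemma weight_nonneg {u : V} {m : geD (del G u) → ℝ} (hm : ∀ d, 0 ≤ m d) (x : leftSide G u)
    (H : rightSide G u) : 0 ≤ weight G u m x H :=
  finsum_nonneg fun _ => finsum_nonneg fun _ => hm _

lemma accuracy_div {n : ℕ} (hn : 0 < n) {ε : ℝ} (h0 : 0 < ε) (h1 : ε ≤ 1) :
    0 < ε / (2 * (n : ℝ)) ∧ ε / (2 * (n : ℝ)) ≤ 1 := by
  have : (1 : ℝ) ≤ n := by exact_mod_cast hn
  refine ⟨by positivity, ?_⟩
  rw [div_le_one (by positivity)]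
  linarith

variable {P : Subroutine.{u}} {U : ChoiceRule.{u}}

/-- Every return value is an estimate; the upper bound is sharper than `1 + ε`, which makes the
induction work. -/
lemma Returns.bounds (hP : P.ComputesPermanent) {ε r : ℝ} (h : Returns P U G ε r) [hV : Finite V]
    (h0 : 0 < ε) (h1 : ε ≤ 1) :
    (1 - ε) * numPM G ≤ r ∧ r ≤ Real.exp (2 / 3 * ε) * numPM G := by
  revert hV h0 h1
  induction h with
  | empty G ε =>
    intro _ h0 h1
    rw [numPM_of_isEmpty]
    have := Real.one_le_exp (x := 2 / 3 * ε) (by positivity)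
    constructor <;> push_cast <;> linarith
  | @step V G ε u hu m hm mC hC p hp ihm ihC =>
    intro hV h0 h1
    have : Nonempty V := ⟨u⟩
    obtain ⟨hδ0, hδ1⟩ := accuracy_div (Nat.card_pos (α := V)) h0 h1
    have hm' (d) := ihm d hδ0 hδ1
    obtain ⟨hC1, hC2⟩ := ihC (by positivity) (by linarith)
    have hmpos (d) : 0 ≤ m d :=
      le_trans (mul_nonneg (by linarith) (Nat.cast_nonneg _)) (hm' d).1
    -- A vertex alone in its component leaves the empty graph, for which the recursive call returns
    -- exactly `1`.
    have hone (d) (hd : ∀ e, comp G u e = comp G u d → e = d) :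
        m d = numPM (hGraph G u d) := by
      have : IsEmpty ↥(((dGraph G u).connectedComponentMk d).supp \ {d}) :=
        ⟨fun e => e.2.2 (hd e.1 e.2.1)⟩
      rw [numPM_of_isEmpty, (hm d).eq_one, Nat.cast_one]
    obtain ⟨hp1, hp2⟩ := permanent_bounds h0 h1 hone (fun d => (hm' d).1) fun d => (hm' d).2
    obtain ⟨hq1, hq2⟩ := (hP _ _ (weight G u m) (ε / 3) (weight_nonneg hmpos) (by positivity)
      (by linarith)).2 p hp
    rw [← numPM_mul_permanent u]
    have hper := permanent_nonneg (weight_nonneg (G := G) (u := u)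
      (m := fun v => (numPM (hGraph G u v) : ℝ)) fun _ => Nat.cast_nonneg _)
    have hperm := permanent_nonneg (weight_nonneg (G := G) (u := u) hmpos)
    generalize permanent (weight G u fun v => (numPM (hGraph G u v) : ℝ)) = z at *
    generalize permanent (weight G u m) = q at *
    have hc : (0 : ℝ) ≤ numPM (cGraph G u) := Nat.cast_nonneg _
    generalize (numPM (cGraph G u) : ℝ) = c at *
    have hmC : 0 ≤ mC := le_trans (mul_nonneg (by linarith) hc) hC1
    have hp0 : 0 ≤ p := le_trans (mul_nonneg (by linarith) hperm) hq1
    constructor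
    -- The relative losses add up to at most `ε/3 + ε/3 + ε/6 = 5ε/6`.
    · calc (1 - ε) * (c * z) ≤ ((1 - ε / 3) * ((1 - ε / 3) * (1 - ε / 6))) * (c * z) := by
            refine mul_le_mul_of_nonneg_right ?_ (mul_nonneg hc hper)
            nlinarith [mul_nonneg h0.le h0.le, mul_nonneg (mul_nonneg h0.le h0.le) (sub_nonneg.2 h1)]
        _ = ((1 - ε / 3) * c) * ((1 - ε / 3) * ((1 - ε / 6) * z)) := by ring
        _ ≤ mC * p := by
            refine mul_le_mul hC1 (le_trans ?_ hq1) ?_ hmC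
            · exact mul_le_mul_of_nonneg_left hp1 (by linarith)
            · exact mul_nonneg (by linarith) (mul_nonneg (by linarith) hper)
    · have he : 1 + ε / 3 ≤ Real.exp (ε / 3) := by
        rw [add_comm]; exact Real.add_one_le_exp _
      calc mC * p ≤ (Real.exp (2 / 3 * (ε / 3)) * c) *
            (Real.exp (ε / 3) * (Real.exp (ε / 9) * z)) := by
            refine mul_le_mul hC2 (hq2.trans ?_) hp0 (by positivity)
            exact mul_le_mul he hp2 hperm (Real.exp_pos _).le
        -- The constant `2/3` solves `c = c/3 + 1/3 + c/6`, the three contributions being `C(G -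
        -- u)`, the subroutine and the weights.
        _ = Real.exp (2 / 3 * (ε / 3) + ε / 3 + ε / 9) * (c * z) := by
            rw [Real.exp_add, Real.exp_add]; ring
        _ = _ := by
            congr 2; ring

/-! ### Termination -/

lemma card_subtype_lt [Finite V] {u : V} {s : Set ({u}ᶜ : Set V)} : Nat.card s < Nat.card V := by
  refine lt_of_le_of_lt (Nat.card_le_card_of_injective _ Subtype.val_injective) ?_
  rw [Nat.card_coe_set_eq]
  exact ncard_lt_card (by simp)

/-- The recursive algorithm returns a value. -/
lemma exists_returns (hP : P.ComputesPermanent) (hU : U.Total) (n : ℕ) :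
    ∀ {V : Type u} [Finite V] (G : SimpleGraph V), Nat.card V = n → ∀ ε : ℝ, 0 < ε → ε ≤ 1 →
      ∃ r, Returns P U G ε r := by
  induction n using Nat.strong_induction_on with
  | _ n ih =>
    intro V _ G hn ε h0 h1
    rcases isEmpty_or_nonempty V with hV | hV
    · exact ⟨1, .empty G ε⟩
    · obtain ⟨u, hu⟩ := hU V G ε
      obtain ⟨hδ0, hδ1⟩ := accuracy_div (Nat.card_pos (α := V)) h0 h1
      choose m hm using fun d => ih _ (hn ▸ lt_of_le_of_lt
        (Nat.card_le_card_of_injective _ Subtype.val_injective) card_subtype_lt)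
        (hGraph G u d) rfl _ hδ0 hδ1
      obtain ⟨mC, hC⟩ := ih _ (hn ▸ card_subtype_lt) (cGraph G u) rfl (ε / 3) (by positivity)
        (by linarith)
      -- The subroutine is only guaranteed to answer on nonnegative weights, so existence of a
      -- return value already needs the lower bound on the estimates.
      have hmpos (d) : 0 ≤ m d :=
        le_trans (mul_nonneg (by linarith) (Nat.cast_nonneg _)) ((hm d).bounds hP hδ0 hδ1).1
      obtain ⟨p, hp⟩ := (hP _ _ (weight G u m) (ε / 3) (weight_nonneg hmpos) (by positivity)
        (by linarith)).1
      exact ⟨_, .step G ε u hu m hm mC hC p hp⟩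

end RecCount

theorem theorem3 {V : Type u} [Finite V] (G : SimpleGraph V) :
    (∀ u : V,
      (RecCount.numPM (RecCount.cGraph G u) : ℝ) *
          RecCount.permanent
            (RecCount.weight G u fun v => (RecCount.numPM (RecCount.hGraph G u v) : ℝ)) =
        (RecCount.numPM G : ℝ)) ∧
    ∀ (P : RecCount.Subroutine.{u}) (U : RecCount.ChoiceRule.{u}),
      P.ComputesPermanent → U.Total →
      ∀ ε : ℝ, 0 < ε → ε ≤ 1 →
        (∃ r : ℝ, RecCount.Returns P U G ε r) ∧
        ∀ r : ℝ, RecCount.Returns P U G ε r → RecCount.Within ε r (RecCount.numPM G : ℝ) := by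
  refine ⟨RecCount.numPM_mul_permanent, fun P U hP hU ε h0 h1 =>
    ⟨RecCount.exists_returns hP hU _ G rfl ε h0 h1, fun r hr => ?_⟩⟩
  obtain ⟨hl, hr⟩ := hr.bounds hP h0 h1
  exact ⟨hl, hr.trans (mul_le_mul_of_nonneg_right
    (RecCount.exp_two_thirds_mul_le h0.le h1) (Nat.cast_nonneg _))⟩
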